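/- Let $\mathcal H$ be a finite-dimensional complex Hilbert space, let $\rho,\sigma_1,\dots,\sigma_r$ be density operators (positive semidefinite operators of trace $1$) on $\mathcal H$, let $0<p<1$, and let $q_1,\dots,q_r>0$ with $\sum_{i=1}^r q_i=1$. Let $\log$ be the logarithm to a fixed base larger than $1$, with $\log 0:=-\infty$. For positive semidefinite operators $A,B$ on the same space let $$P_e^*(A,B):=\min\{\operatorname{Tr}A(I-E_1)+\operatorname{Tr}B(I-E_2)\,:\,E_1,E_2\ge 0,\ E_1+E_2\le I\}$$ be the optimal error probability of discriminating $A$ from $B$, and let $$C(A,B):=-\log\min_{0\le s\le 1}\operatorname{Tr}A^sB^{1-s}\in(-\infty,+\infty]$$ be their Chernoff divergence, where powers of a positive semidefinite operator are taken on its support only (so that $A^0$ is the projection onto the support of $A$). Then, in the extended real line, $$-\min_i C(\rho,\sigma_i)\le\liminf_{n\to\infty}\frac1n\log P_e^*\Big(p\rho^{\otimes n},(1-p)\sum_i q_i\sigma_i^{\otimes n}\Big)\le\limsup_{n\to\infty}\frac1n\log P_e^*\Big(p\rho^{\otimes n},(1-p)\sum_i q_i\sigma_i^{\otimes n}\Big)\le-\frac12\min_i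 C(\rho,\sigma_i).$$ If moreover $\rho$ is pure (that is, of rank one), then the limit exists and $$\lim_{n\to\infty}\frac1n\log P_e^*\Big(p\rho^{\otimes n},(1-p)\sum_i q_i\sigma_i^{\otimes n}\Big)=-\min_i C(\rho,\sigma_i).$$ -/

import Mathlib

open Filter Topology
open scoped ComplexOrder

namespace StateDiscrimination

noncomputable section

/-- Logarithm to base `b` of a nonnegative real number, with the convention `log 0 = -∞`. -/
def extLog (b x : ℝ) : EReal :=
  if x = 0 then ⊥ else ((Real.logb b x : ℝ) : EReal)

/-- Density operators (states) on the Hilbert space `ℂ^d`: positive semidefinite, of unit trace. -/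
structure IsState {d : Type*} [Fintype d] (ρ : Matrix d d ℂ) : Prop where
  posSemidef : ρ.PosSemidef
  trace_eq_one : ρ.trace = 1

/-- Purity of a state: it is of the form `|ψ⟩⟨ψ|`. -/
def IsPure {d : Type*} (ρ : Matrix d d ℂ) : Prop :=
  ∃ ψ : d → ℂ, ρ = Matrix.vecMulVec ψ (star ψ)

/-- The `n`-fold tensor power `A^{⊗n}` on `(ℂ^d)^{⊗n} = ℂ^(d^n)`, in the product basis. -/
def tensorPow {d : Type*} (A : Matrix d d ℂ) (n : ℕ) : Matrix (Fin n → d) (Fin n → d) ℂ :=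
  Matrix.of fun x y => ∏ k, A (x k) (y k)

/-- The real power `A^s` of a positive semidefinite matrix, taken on its support only:
the eigenvalue `0` stays `0` for every `s`; in particular `A^0` is the support projection. -/
def supportPow {d : Type*} [Fintype d] [DecidableEq d] (A : Matrix d d ℂ) (s : ℝ) :
    Matrix d d ℂ :=
  cfc (fun x : ℝ => if x = 0 then 0 else x ^ s) A

/-- `Q_s(A‖B) = Tr A^s B^(1-s)`. -/
def chernoffQ {d : Type*} [Fintype d] [DecidableEq d] (A B : Matrix d d ℂ) (s : ℝ) : ℝ :=
  (supportPow A s * supportPow B (1 - s)).trace.re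

/-- `Q_min(A, B)`, the minimum of `Q_s(A‖B)` over `0 ≤ s ≤ 1`. -/
def chernoffQMin {d : Type*} [Fintype d] [DecidableEq d] (A B : Matrix d d ℂ) : ℝ :=
  sInf (chernoffQ A B '' Set.Icc 0 1)

/-- The Chernoff divergence `C(A, B) = -log Q_min(A, B)`, with logarithm to base `b`. -/
def chernoffDiv {d : Type*} [Fintype d] [DecidableEq d] (b : ℝ) (A B : Matrix d d ℂ) : EReal :=
  -extLog b (chernoffQMin A B)

/-- A POVM with `r` outcomes: positive semidefinite `E₁, …, E_r` with `E₁ + ⋯ + E_r ≤ I`. -/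
structure IsPOVM {d : Type*} [Fintype d] [DecidableEq d] {r : ℕ}
    (E : Fin r → Matrix d d ℂ) : Prop where
  posSemidef : ∀ i, (E i).PosSemidef
  sum_le_one : (1 - ∑ i, E i).PosSemidef

/-- The error `P_e({E_i}) = ∑ i, Tr A_i (I - E_i)` of a measurement for the hypotheses `A_i`. -/
def errorProb {d : Type*} [Fintype d] [DecidableEq d] {r : ℕ}
    (A E : Fin r → Matrix d d ℂ) : ℝ :=
  ∑ i, (A i * (1 - E i)).trace.re

/-- The optimal error probability `P_e^*(A₁, …, A_r)`: the minimum over all POVMs. -/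
def optError {d : Type*} [Fintype d] [DecidableEq d] {r : ℕ}
    (A : Fin r → Matrix d d ℂ) : ℝ :=
  sInf (errorProb A '' {E | IsPOVM E})

/-- The i.i.d. hypothesis `p ρ^{⊗n}`. -/
def iidHyp {d : Type*} (p : ℝ) (ρ : Matrix d d ℂ) (n : ℕ) :
    Matrix (Fin n → d) (Fin n → d) ℂ :=
  (p : ℂ) • tensorPow ρ n

/-- The averaged i.i.d. hypothesis `(1 - p) ∑ i, q_i σ_i^{⊗n}`. -/
def avgIidHyp {d : Type*} {r : ℕ} (p : ℝ) (q : Fin r → ℝ) (σ : Fin r → Matrix d d ℂ) (n : ℕ) :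
    Matrix (Fin n → d) (Fin n → d) ℂ :=
  ((1 - p : ℝ) : ℂ) • ∑ i, (q i : ℂ) • tensorPow (σ i) n

/-- The normalized logarithm of the optimal error probability,
`(1/n) log P_e^*(p ρ^{⊗n}, (1 - p) ∑ i, q_i σ_i^{⊗n})`. -/
def errorRate {d : Type*} [Fintype d] [DecidableEq d] {r : ℕ} (b p : ℝ) (q : Fin r → ℝ)
    (ρ : Matrix d d ℂ) (σ : Fin r → Matrix d d ℂ) (n : ℕ) : EReal :=
  ((1 / (n : ℝ) : ℝ) : EReal) * extLog b (optError ![iidHyp p ρ n, avgIidHyp p q σ n])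

end

end StateDiscrimination

/-! Minimizing the divergence over `i` means maximizing `chernoffQMin ρ (σ i)`; call the maximum
`M`. Everything reduces to geometric bounds on the optimal error.

Lower bound, rate `M`: inside the averaged hypothesis only one `σ i` is kept, which costs a constant
factor. For two states, `sum_min_mul_overlap_le` bounds the error of every test below by that of a
classical problem on pairs of eigenvectors. This problem is again i.i.d., and its Chernoff sums are
exactly `chernoffQ`. The classical lower bound `eventually_le_sum_prod_mul_min` then applies.

Upper bound, rate `√M`: `exists_projection_error_le_chernoffQ` gives for each `i` a projection `F i`
separating the tensor powers with error at most `M ^ n`. These need not commute;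
`exists_common_test` merges them into the spectral projection of `∑ i, (1 - F i)` for eigenvalues at
most `c`. The errors become of order `M ^ n / c` and `M ^ n + c`, and the balance `c = √M ^ n` is
where the factor one half comes from.

Pure `ρ`: the projection `tensorPow ρ n` is itself the test. It never rejects `ρ`, and it accepts `σ
i` with probability `(Tr ρ σ i) ^ n ≤ M ^ n`, so no merging is needed. -/

namespace StateDiscrimination

open Matrix

/-! ### Spectral decompositions and traces in two eigenbases -/

section Spectral

variable {d : Type*} [Fintype d] [DecidableEq d]

/-- The Hermitian matrix with eigenvalues `l` and the columns of `U` as eigenvectors. -/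
noncomputable def spectralMatrix (U : unitaryGroup d ℂ) (l : d → ℝ) : Matrix d d ℂ :=
  (U : Matrix d d ℂ) * diagonal (fun i => (l i : ℂ)) * (U : Matrix d d ℂ)ᴴ

theorem unitary_mul_conjTranspose (U : unitaryGroup d ℂ) :
    (U : Matrix d d ℂ) * (U : Matrix d d ℂ)ᴴ = 1 := mem_unitaryGroup_iff.mp U.2

theorem unitary_conjTranspose_mul (U : unitaryGroup d ℂ) :
    (U : Matrix d d ℂ)ᴴ * (U : Matrix d d ℂ) = 1 := mem_unitaryGroup_iff'.mp U.2

/-- `spectralMatrix U` as a homomorphism of real algebras. -/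
noncomputable def spectralAlgHom (U : unitaryGroup d ℂ) : (d → ℝ) →ₐ[ℝ] Matrix d d ℂ where
  toFun := spectralMatrix U
  map_one' := by
    have : diagonal (fun _ : d => (1 : ℂ)) = 1 := diagonal_one
    simp [spectralMatrix, this, unitary_mul_conjTranspose]
  map_mul' l m := by
    have : diagonal (fun i => ((l i * m i : ℝ) : ℂ)) =
        diagonal (fun i => (l i : ℂ)) * diagonal (fun i => (m i : ℂ)) := by
      simp [diagonal_mul_diagonal]
    simp only [spectralMatrix, Pi.mul_apply, this]
    calc _ = (U : Matrix d d ℂ) * diagonal (fun i => (l i : ℂ)) * 1 *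
          diagonal (fun i => (m i : ℂ)) * (U : Matrix d d ℂ)ᴴ := by simp [Matrix.mul_assoc]
      _ = _ := by rw [← unitary_conjTranspose_mul U]; simp only [Matrix.mul_assoc]
  map_zero' := by simp [spectralMatrix]
  map_add' l m := by
    have : diagonal (fun i => ((l i + m i : ℝ) : ℂ)) =
        diagonal (fun i => (l i : ℂ)) + diagonal (fun i => (m i : ℂ)) := by
      simp [diagonal_add]
    simp only [spectralMatrix, Pi.add_apply, this, Matrix.mul_add, Matrix.add_mul]
  commutes' r := by
    have : diagonal (fun i => ((algebraMap ℝ (d → ℝ) r i : ℝ) : ℂ)) = (r : ℂ) • 1 := by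
      ext i j; simp [diagonal_apply, one_apply]
    simp only [spectralMatrix, this]
    simp only [mul_smul_comm, smul_mul_assoc, mul_one, unitary_mul_conjTranspose]
    ext i j; simp [algebraMap_matrix_apply, one_apply]

theorem spectralAlgHom_apply (U : unitaryGroup d ℂ) (l : d → ℝ) :
    spectralAlgHom U l = spectralMatrix U l := rfl

theorem spectralMatrix_mul (U : unitaryGroup d ℂ) (l m : d → ℝ) :
    spectralMatrix U l * spectralMatrix U m = spectralMatrix U (l * m) :=
  ((spectralAlgHom U).map_mul l m).symm

theorem spectralMatrix_sub (U : unitaryGroup d ℂ) (l m : d → ℝ) :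
    spectralMatrix U l - spectralMatrix U m = spectralMatrix U (l - m) :=
  ((spectralAlgHom U).map_sub l m).symm

theorem spectralMatrix_one (U : unitaryGroup d ℂ) : spectralMatrix U 1 = 1 :=
  (spectralAlgHom U).map_one

theorem spectralMatrix_isHermitian (U : unitaryGroup d ℂ) (l : d → ℝ) :
    (spectralMatrix U l).IsHermitian := by
  apply isHermitian_mul_mul_conjTranspose
  rw [IsHermitian, diagonal_conjTranspose]
  congr; ext i; simp

theorem spectralMatrix_posSemidef (U : unitaryGroup d ℂ) {l : d → ℝ} (hl : 0 ≤ l) :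
    (spectralMatrix U l).PosSemidef := by
  apply PosSemidef.mul_mul_conjTranspose_same
  exact PosSemidef.diagonal fun i => by simpa using hl i

theorem exists_eq_spectralMatrix {A : Matrix d d ℂ} (hA : A.IsHermitian) :
    ∃ U : unitaryGroup d ℂ, A = spectralMatrix U hA.eigenvalues := by
  refine ⟨hA.eigenvectorUnitary, ?_⟩
  conv_lhs => rw [hA.spectral_theorem, Unitary.conjStarAlgAut_apply]
  rfl

theorem exists_eq_spectralMatrix_of_posSemidef {A : Matrix d d ℂ} (hA : A.PosSemidef) :
    ∃ (U : unitaryGroup d ℂ) (l : d → ℝ), 0 ≤ l ∧ A = spectralMatrix U l := by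
  obtain ⟨U, hU⟩ := exists_eq_spectralMatrix hA.isHermitian
  exact ⟨U, _, fun i => hA.eigenvalues_nonneg i, hU⟩

/-- A polynomial interpolating `f` on a finite set computes the functional calculus, and polynomials
commute with the algebra homomorphism `spectralAlgHom U`. Interpolating on the spectrum and on the
range of `l` together avoids having to identify the two sets. -/
theorem cfc_spectralMatrix (U : unitaryGroup d ℂ) (l : d → ℝ) (f : ℝ → ℝ) :
    cfc f (spectralMatrix U l) = spectralMatrix U (f ∘ l) := by
  have hfin : ((spectrum ℝ (spectralMatrix U l)) ∪ Set.range l).Finite :=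
    (finite_real_spectrum).union (Set.finite_range l)
  set q : Polynomial ℝ := Lagrange.interpolate hfin.toFinset id f with hq
  have hqe : ∀ x ∈ (spectrum ℝ (spectralMatrix U l)) ∪ Set.range l, q.eval x = f x := by
    intro x hx
    exact Lagrange.eval_interpolate_at_node f (v := id) (Set.injOn_id _)
      (hfin.mem_toFinset.mpr hx)
  have hsa : IsSelfAdjoint (spectralMatrix U l) := spectralMatrix_isHermitian U l
  rw [cfc_congr (g := q.eval) (fun x hx => (hqe x (Or.inl hx)).symm), cfc_polynomial q _ hsa,
    ← spectralAlgHom_apply, Polynomial.aeval_algHom_apply, spectralAlgHom_apply]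
  congr 1
  ext i
  simp only [Polynomial.aeval_pi, Function.comp_apply]
  exact hqe _ (Or.inr ⟨i, rfl⟩)

theorem trace_diagonal_conj (W : Matrix d d ℂ) (l m : d → ℝ) :
    (diagonal (fun i => (l i : ℂ)) * W * diagonal (fun i => (m i : ℂ)) * Wᴴ).trace.re =
      ∑ i, ∑ j, l i * m j * ‖W i j‖ ^ 2 := by
  simp only [trace, diag_apply, Complex.re_sum]
  refine Finset.sum_congr rfl fun i _ => ?_
  rw [mul_apply, Complex.re_sum]
  refine Finset.sum_congr rfl fun j _ => ?_
  rw [mul_diagonal, diagonal_mul, conjTranspose_apply]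
  have : (l i : ℂ) * W i j * (m j : ℂ) * star (W i j) = ((l i * m j * ‖W i j‖ ^ 2 : ℝ) : ℂ) := by
    have h := Complex.mul_conj' (W i j)
    push_cast
    rw [← h]
    simp only [Complex.star_def]; ring
  rw [this, Complex.ofReal_re]

/-- Squared overlaps of the columns of `U` and `V`. -/
noncomputable def overlap (U V : unitaryGroup d ℂ) (i j : d) : ℝ :=
  ‖((U : Matrix d d ℂ)ᴴ * (V : Matrix d d ℂ)) i j‖ ^ 2

theorem overlap_nonneg (U V : unitaryGroup d ℂ) (i j : d) : 0 ≤ overlap U V i j := by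
  unfold overlap; positivity

theorem trace_spectralMatrix_mul (U V : unitaryGroup d ℂ) (l m : d → ℝ) :
    (spectralMatrix U l * spectralMatrix V m).trace.re =
      ∑ i, ∑ j, l i * m j * overlap U V i j := by
  unfold overlap
  rw [← trace_diagonal_conj, spectralMatrix, spectralMatrix, Matrix.mul_assoc, Matrix.mul_assoc,
    trace_mul_comm]
  simp only [conjTranspose_mul, conjTranspose_conjTranspose, Matrix.mul_assoc]

/-- The basis `V` is arbitrary, inserted through `V Vᴴ = 1`. This lets both error terms of a test be
expanded over the same index pairs. -/
theorem trace_spectralMatrix_mul_self_conjTranspose (U V : unitaryGroup d ℂ) (l : d → ℝ)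
    (M : Matrix d d ℂ) :
    (spectralMatrix U l * (M * Mᴴ)).trace.re =
      ∑ i, ∑ j, l i * ‖((U : Matrix d d ℂ)ᴴ * M * (V : Matrix d d ℂ)) i j‖ ^ 2 := by
  have := trace_diagonal_conj ((U : Matrix d d ℂ)ᴴ * M * (V : Matrix d d ℂ)) l 1
  have h1 : diagonal (fun _ : d => (1 : ℂ)) = 1 := diagonal_one
  simp only [Pi.one_apply, Complex.ofReal_one, h1, mul_one] at this
  rw [← this, spectralMatrix, Matrix.mul_assoc, Matrix.mul_assoc, trace_mul_comm]
  simp only [conjTranspose_mul, conjTranspose_conjTranspose, Matrix.mul_assoc]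
  rw [← Matrix.mul_assoc (V : Matrix d d ℂ), unitary_mul_conjTranspose, Matrix.one_mul]

theorem trace_spectralMatrix_mul_conjTranspose_self (U V : unitaryGroup d ℂ) (m : d → ℝ)
    (M : Matrix d d ℂ) :
    (spectralMatrix V m * (Mᴴ * M)).trace.re =
      ∑ i, ∑ j, m j * ‖((U : Matrix d d ℂ)ᴴ * M * (V : Matrix d d ℂ)) i j‖ ^ 2 := by
  have := trace_spectralMatrix_mul_self_conjTranspose V U m Mᴴ
  rw [conjTranspose_conjTranspose] at this
  rw [this, Finset.sum_comm]
  refine Finset.sum_congr rfl fun i _ => Finset.sum_congr rfl fun j _ => ?_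
  have h : (V : Matrix d d ℂ)ᴴ * Mᴴ * (U : Matrix d d ℂ) =
      ((U : Matrix d d ℂ)ᴴ * M * (V : Matrix d d ℂ))ᴴ := by
    simp [conjTranspose_mul, Matrix.mul_assoc]
  rw [h, conjTranspose_apply, norm_star]

theorem sum_overlap_right (U V : unitaryGroup d ℂ) (i : d) : ∑ j, overlap U V i j = 1 := by
  have h : ((U : Matrix d d ℂ)ᴴ * (V : Matrix d d ℂ)) *
      ((U : Matrix d d ℂ)ᴴ * (V : Matrix d d ℂ))ᴴ = 1 := by
    rw [conjTranspose_mul, conjTranspose_conjTranspose, Matrix.mul_assoc,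
      ← Matrix.mul_assoc (V : Matrix d d ℂ), unitary_mul_conjTranspose, Matrix.one_mul,
      unitary_conjTranspose_mul]
  have h2 := congrFun (congrFun h i) i
  rw [mul_apply] at h2
  simp only [conjTranspose_apply, Complex.star_def, Complex.mul_conj', one_apply_eq] at h2
  unfold overlap
  exact_mod_cast h2

theorem trace_spectralMatrix (U : unitaryGroup d ℂ) (l : d → ℝ) :
    (spectralMatrix U l).trace.re = ∑ i, l i := by
  have h := trace_spectralMatrix_mul U U l 1
  rw [spectralMatrix_one, mul_one] at h
  simp [h, ← Finset.mul_sum, sum_overlap_right]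

theorem trace_mul_nonneg {A B : Matrix d d ℂ} (hA : A.PosSemidef) (hB : B.PosSemidef) :
    0 ≤ (A * B).trace.re := by
  obtain ⟨U, l, hl, rfl⟩ := exists_eq_spectralMatrix_of_posSemidef hA
  obtain ⟨V, m, hm, rfl⟩ := exists_eq_spectralMatrix_of_posSemidef hB
  rw [trace_spectralMatrix_mul]
  exact Finset.sum_nonneg fun i _ => Finset.sum_nonneg fun j _ =>
    mul_nonneg (mul_nonneg (hl i) (hm j)) (overlap_nonneg U V i j)

end Spectral

/-! ### Tensor powers -/

section Tensor

variable {d : Type*}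

theorem tensorPow_mul [Fintype d] (A B : Matrix d d ℂ) (n : ℕ) :
    tensorPow (A * B) n = tensorPow A n * tensorPow B n := by
  ext x y
  simp only [tensorPow, of_apply, mul_apply, Finset.prod_univ_sum, Fintype.piFinset_univ,
    Finset.prod_mul_distrib]

theorem tensorPow_conjTranspose (A : Matrix d d ℂ) (n : ℕ) :
    (tensorPow A n)ᴴ = tensorPow Aᴴ n := by
  ext x y
  simp [tensorPow, conjTranspose_apply]

theorem tensorPow_diagonal [DecidableEq d] (v : d → ℂ) (n : ℕ) :
    tensorPow (diagonal v) n = diagonal fun x : Fin n → d => ∏ k, v (x k) := by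
  ext x y
  simp only [tensorPow, of_apply, diagonal_apply]
  split_ifs with h
  · subst h; simp
  · obtain ⟨k, hk⟩ := Function.ne_iff.mp h
    exact Finset.prod_eq_zero (Finset.mem_univ k) (if_neg hk)

theorem tensorPow_one [DecidableEq d] (n : ℕ) : tensorPow (1 : Matrix d d ℂ) n = 1 := by
  rw [← diagonal_one, tensorPow_diagonal]; simp

theorem trace_tensorPow [Fintype d] (A : Matrix d d ℂ) (n : ℕ) : (tensorPow A n).trace = A.trace ^ n := by
  have h : (tensorPow A n).trace = ∑ x : Fin n → d, ∏ k, A (x k) (x k) := rfl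
  rw [h, trace, Fintype.sum_pow]
  rfl

variable [Fintype d] [DecidableEq d]

/-- Tensor power of a unitary matrix. -/
def tensorUnitary (U : unitaryGroup d ℂ) (n : ℕ) : unitaryGroup (Fin n → d) ℂ :=
  ⟨tensorPow (U : Matrix d d ℂ) n, by
    rw [mem_unitaryGroup_iff, star_eq_conjTranspose, tensorPow_conjTranspose, ← tensorPow_mul,
      unitary_mul_conjTranspose, tensorPow_one]⟩

theorem tensorPow_spectralMatrix (U : unitaryGroup d ℂ) (l : d → ℝ) (n : ℕ) :
    tensorPow (spectralMatrix U l) n =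
      spectralMatrix (tensorUnitary U n) fun x => ∏ k, l (x k) := by
  simp only [spectralMatrix, tensorPow_mul, tensorPow_diagonal, tensorUnitary,
    tensorPow_conjTranspose, Complex.ofReal_prod]

theorem overlap_tensorUnitary (U V : unitaryGroup d ℂ) (n : ℕ) (x y : Fin n → d) :
    overlap (tensorUnitary U n) (tensorUnitary V n) x y = ∏ k, overlap U V (x k) (y k) := by
  unfold overlap tensorUnitary
  rw [tensorPow_conjTranspose, ← tensorPow_mul]
  simp [tensorPow, Finset.prod_pow]

theorem posSemidef_tensorPow {A : Matrix d d ℂ} (hA : A.PosSemidef) (n : ℕ) :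
    (tensorPow A n).PosSemidef := by
  obtain ⟨U, l, hl, rfl⟩ := exists_eq_spectralMatrix_of_posSemidef hA
  rw [tensorPow_spectralMatrix]
  exact spectralMatrix_posSemidef _ fun x => Finset.prod_nonneg fun k _ => hl _

/-- Sums of product functions over pairs of words factorize. -/
theorem sum_sum_prod_eq_pow {X : Type*} [Fintype X] (f : X → X → ℝ) (n : ℕ) :
    ∑ x : Fin n → X, ∑ y : Fin n → X, ∏ k, f (x k) (y k) = (∑ i, ∑ j, f i j) ^ n := by
  classical
  rw [Fintype.sum_pow]
  refine Finset.sum_congr rfl fun x _ => ?_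
  rw [Finset.prod_univ_sum, Fintype.piFinset_univ]

end Tensor

/-! ### Powers on the support and the Chernoff quantity -/

section SupportPow

variable {d : Type*} [Fintype d] [DecidableEq d]

/-- The real power `x ^ s`, with `0 ^ s = 0` for every `s`. -/
noncomputable def supportRpow (s x : ℝ) : ℝ := if x = 0 then 0 else x ^ s

theorem supportRpow_nonneg {x : ℝ} (hx : 0 ≤ x) (s : ℝ) : 0 ≤ supportRpow s x := by
  unfold supportRpow; split_ifs
  · rfl
  · positivity

/-- The support convention keeps the exponents `0` and `1` from being exceptional: the minimum over
`[0, 1]` is attained, and bounds on the open interval extend to the endpoints. -/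
theorem continuous_supportRpow (x : ℝ) : Continuous fun s => supportRpow s x := by
  unfold supportRpow
  by_cases h : x = 0
  · simpa [h] using continuous_const
  · simpa [h] using Real.continuous_const_rpow h

theorem supportRpow_of_pos {s : ℝ} (hs : 0 < s) (x : ℝ) : supportRpow s x = x ^ s := by
  unfold supportRpow; split_ifs with h
  · rw [h, Real.zero_rpow hs.ne']
  · rfl

theorem supportRpow_mul_one_sub {s : ℝ} {x : ℝ} (hx : 0 ≤ x) :
    supportRpow s x * supportRpow (1 - s) x = x := by
  unfold supportRpow; split_ifs with h
  · simp [h]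
  · rw [← Real.rpow_add (lt_of_le_of_ne hx (Ne.symm h))]; simp

theorem supportRpow_prod {ι : Type*} (t : Finset ι) {f : ι → ℝ} (hf : ∀ i, 0 ≤ f i) (s : ℝ) :
    supportRpow s (∏ i ∈ t, f i) = ∏ i ∈ t, supportRpow s (f i) := by
  unfold supportRpow
  split_ifs with h
  · obtain ⟨i, hi, h0⟩ := Finset.prod_eq_zero_iff.mp h
    symm
    exact Finset.prod_eq_zero hi (if_pos h0)
  · rw [← Real.finsetProd_rpow _ _ fun i _ => hf i]
    refine Finset.prod_congr rfl fun i hi => (if_neg ?_).symm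
    exact Finset.prod_ne_zero_iff.mp h i hi

theorem self_le_supportRpow {s x : ℝ} (hs : s ≤ 1) (hx : 0 ≤ x) (hx1 : x ≤ 1) :
    x ≤ supportRpow s x := by
  unfold supportRpow; split_ifs with h
  · exact h.le
  · exact Real.self_le_rpow_of_le_one hx hx1 hs

theorem supportPow_spectralMatrix (U : unitaryGroup d ℂ) (l : d → ℝ) (s : ℝ) :
    supportPow (spectralMatrix U l) s = spectralMatrix U (supportRpow s ∘ l) :=
  cfc_spectralMatrix U l _

theorem supportPow_posSemidef {A : Matrix d d ℂ} (hA : A.PosSemidef) (s : ℝ) :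
    (supportPow A s).PosSemidef := by
  obtain ⟨U, l, hl, rfl⟩ := exists_eq_spectralMatrix_of_posSemidef hA
  rw [supportPow_spectralMatrix]
  exact spectralMatrix_posSemidef U fun i => supportRpow_nonneg (hl i) s

theorem supportPow_mul_one_sub {A : Matrix d d ℂ} (hA : A.PosSemidef) (s : ℝ) :
    supportPow A s * supportPow A (1 - s) = A := by
  obtain ⟨U, l, hl, rfl⟩ := exists_eq_spectralMatrix_of_posSemidef hA
  rw [supportPow_spectralMatrix, supportPow_spectralMatrix, spectralMatrix_mul]
  congr 1
  ext i
  exact supportRpow_mul_one_sub (hl i)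

open scoped MatrixOrder Matrix.Norms.L2Operator in
/-- Operator monotonicity of `A ↦ A ^ s` for `0 < s ≤ 1`. -/
theorem supportPow_mono {A B : Matrix d d ℂ} (hA : A.PosSemidef) (hAB : (B - A).PosSemidef)
    {s : ℝ} (hs0 : 0 < s) (hs1 : s ≤ 1) : (supportPow B s - supportPow A s).PosSemidef := by
  have h : A ≤ B := hAB
  have hA0 : 0 ≤ A := hA.nonneg
  have key := CFC.rpow_le_rpow (p := s) ⟨hs0.le, hs1⟩ h
  rw [CFC.rpow_eq_cfc_real hA0, CFC.rpow_eq_cfc_real (hA0.trans h)] at key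
  have e : (fun x : ℝ => x ^ s) = fun x : ℝ => if x = 0 then 0 else x ^ s :=
    funext fun x => (supportRpow_of_pos hs0 x).symm
  rw [e] at key
  exact key

theorem chernoffQ_spectralMatrix (U V : unitaryGroup d ℂ) (l m : d → ℝ) (s : ℝ) :
    chernoffQ (spectralMatrix U l) (spectralMatrix V m) s =
      ∑ i, ∑ j, supportRpow s (l i) * supportRpow (1 - s) (m j) * overlap U V i j := by
  simp only [chernoffQ, supportPow_spectralMatrix, trace_spectralMatrix_mul, Function.comp_apply]

theorem chernoffQ_nonneg {A B : Matrix d d ℂ} (hA : A.PosSemidef) (hB : B.PosSemidef) (s : ℝ) :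
    0 ≤ chernoffQ A B s :=
  trace_mul_nonneg (supportPow_posSemidef hA s) (supportPow_posSemidef hB _)

theorem continuous_chernoffQ {A B : Matrix d d ℂ} (hA : A.IsHermitian) (hB : B.IsHermitian) :
    Continuous (chernoffQ A B) := by
  obtain ⟨U, hU⟩ := exists_eq_spectralMatrix hA
  obtain ⟨V, hV⟩ := exists_eq_spectralMatrix hB
  have : chernoffQ A B = fun s => ∑ i, ∑ j, supportRpow s (hA.eigenvalues i) *
      supportRpow (1 - s) (hB.eigenvalues j) * overlap U V i j := by
    ext s
    rw [← chernoffQ_spectralMatrix, ← hU, ← hV]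
  rw [this]
  refine continuous_finsetSum _ fun i _ => continuous_finsetSum _ fun j _ => ?_
  exact ((continuous_supportRpow _).mul
    ((continuous_supportRpow _).comp (continuous_const.sub continuous_id))).mul continuous_const

theorem chernoffQ_tensorPow {A B : Matrix d d ℂ} (hA : A.PosSemidef) (hB : B.PosSemidef)
    (s : ℝ) (n : ℕ) : chernoffQ (tensorPow A n) (tensorPow B n) s = chernoffQ A B s ^ n := by
  obtain ⟨U, l, hl, rfl⟩ := exists_eq_spectralMatrix_of_posSemidef hA
  obtain ⟨V, m, hm, rfl⟩ := exists_eq_spectralMatrix_of_posSemidef hB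
  rw [tensorPow_spectralMatrix, tensorPow_spectralMatrix, chernoffQ_spectralMatrix,
    chernoffQ_spectralMatrix, ← sum_sum_prod_eq_pow]
  refine Finset.sum_congr rfl fun x _ => Finset.sum_congr rfl fun y _ => ?_
  rw [supportRpow_prod _ fun k => hl (x k), supportRpow_prod _ fun k => hm (y k),
    overlap_tensorUnitary, ← Finset.prod_mul_distrib, ← Finset.prod_mul_distrib]

theorem bddBelow_chernoffQ {A B : Matrix d d ℂ} (hA : A.PosSemidef) (hB : B.PosSemidef) :
    BddBelow (chernoffQ A B '' Set.Icc 0 1) :=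
  ⟨0, by rintro _ ⟨s, -, rfl⟩; exact chernoffQ_nonneg hA hB s⟩

theorem exists_chernoffQMin_eq {A B : Matrix d d ℂ} (hA : A.PosSemidef) (hB : B.PosSemidef) :
    ∃ s ∈ Set.Icc (0 : ℝ) 1, chernoffQMin A B = chernoffQ A B s ∧
      ∀ t ∈ Set.Icc (0 : ℝ) 1, chernoffQ A B s ≤ chernoffQ A B t := by
  obtain ⟨s, hs, h1, h2⟩ := isCompact_Icc.exists_sInf_image_eq_and_le
    (Set.nonempty_Icc.mpr zero_le_one) (continuous_chernoffQ hA.1 hB.1).continuousOn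
  exact ⟨s, hs, h1, h2⟩

theorem chernoffQMin_nonneg {A B : Matrix d d ℂ} (hA : A.PosSemidef) (hB : B.PosSemidef) :
    0 ≤ chernoffQMin A B := by
  obtain ⟨s, -, h, -⟩ := exists_chernoffQMin_eq hA hB
  rw [h]; exact chernoffQ_nonneg hA hB s

theorem IsState.eigenvalue_le_one {U : unitaryGroup d ℂ} {l : d → ℝ} (hl : 0 ≤ l)
    (h : IsState (spectralMatrix U l)) (i : d) : l i ≤ 1 := by
  have h1 := trace_spectralMatrix U l
  rw [h.trace_eq_one, Complex.one_re] at h1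
  rw [h1]
  exact Finset.single_le_sum (fun j _ => hl j) (Finset.mem_univ i)

/-- Eigenvalues of states lie in `[0, 1]`, where raising to a power at most `1` does not decrease
them. -/
theorem trace_mul_le_chernoffQMin {ρ σ : Matrix d d ℂ} (hρ : IsState ρ) (hσ : IsState σ) :
    (ρ * σ).trace.re ≤ chernoffQMin ρ σ := by
  obtain ⟨s, hs, h, -⟩ := exists_chernoffQMin_eq hρ.posSemidef hσ.posSemidef
  rw [h]
  obtain ⟨U, l, hl, rfl⟩ := exists_eq_spectralMatrix_of_posSemidef hρ.posSemidef
  obtain ⟨V, m, hm, rfl⟩ := exists_eq_spectralMatrix_of_posSemidef hσ.posSemidef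
  rw [chernoffQ_spectralMatrix, trace_spectralMatrix_mul]
  refine Finset.sum_le_sum fun i _ => Finset.sum_le_sum fun j _ => ?_
  have h1 := self_le_supportRpow hs.2 (hl i) (hρ.eigenvalue_le_one hl i)
  have h2 := self_le_supportRpow (s := 1 - s) (by linarith [hs.1]) (hm j)
    (hσ.eigenvalue_le_one hm j)
  exact mul_le_mul_of_nonneg_right (mul_le_mul h1 h2 (hm j) (supportRpow_nonneg (hl i) s))
    (overlap_nonneg U V i j)

theorem chernoffQMin_le_one {ρ σ : Matrix d d ℂ} (hρ : IsState ρ) (hσ : IsState σ) :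
    chernoffQMin ρ σ ≤ 1 := by
  refine (csInf_le (bddBelow_chernoffQ hρ.posSemidef hσ.posSemidef)
    ⟨1, Set.right_mem_Icc.mpr zero_le_one, rfl⟩).trans ?_
  obtain ⟨U, l, hl, rfl⟩ := exists_eq_spectralMatrix_of_posSemidef hρ.posSemidef
  obtain ⟨V, m, hm, rfl⟩ := exists_eq_spectralMatrix_of_posSemidef hσ.posSemidef
  have h1 : ∑ i, l i = 1 := by
    rw [← trace_spectralMatrix U l, hρ.trace_eq_one, Complex.one_re]
  rw [chernoffQ_spectralMatrix]
  refine le_of_le_of_eq ?_ h1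
  refine Finset.sum_le_sum fun i _ => ?_
  calc _ ≤ ∑ j, l i * overlap U V i j := Finset.sum_le_sum fun j _ => by
        refine mul_le_mul_of_nonneg_right ?_ (overlap_nonneg U V i j)
        rw [supportRpow_of_pos one_pos, Real.rpow_one]
        refine mul_le_of_le_one_right (hl i) ?_
        unfold supportRpow
        split_ifs <;> simp
    _ = l i := by rw [← Finset.mul_sum, sum_overlap_right, mul_one]

end SupportPow

/-! ### Two-outcome tests and the Nussbaum–Szkoła bound -/

section Error

variable {d : Type*} [Fintype d] [DecidableEq d]

theorem errorProb_nonneg {r : ℕ} {A E : Fin r → Matrix d d ℂ}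
    (hA : ∀ i, (A i).PosSemidef) (hE : IsPOVM E) : 0 ≤ errorProb A E := by
  refine Finset.sum_nonneg fun i _ => trace_mul_nonneg (hA i) ?_
  have : 1 - E i = (1 - ∑ j, E j) + ∑ j ∈ Finset.univ.erase i, E j := by
    rw [← Finset.add_sum_erase _ E (Finset.mem_univ i)]; abel
  rw [this]
  exact hE.sum_le_one.add (posSemidef_sum _ fun j _ => hE.posSemidef j)

theorem posSemidef_pair {d : Type*} {A B : Matrix d d ℂ} (hA : A.PosSemidef) (hB : B.PosSemidef) (i : Fin 2) :
    (![A, B] i).PosSemidef := by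
  fin_cases i <;> assumption

theorem optError_nonneg {A B : Matrix d d ℂ} (hA : A.PosSemidef) (hB : B.PosSemidef) :
    0 ≤ optError ![A, B] := by
  refine Real.sInf_nonneg ?_
  rintro _ ⟨E, hE, rfl⟩
  exact errorProb_nonneg (posSemidef_pair hA hB) hE

/-- A two-outcome test bounds the optimal error probability from above. -/
theorem optError_le {A B E : Matrix d d ℂ} (hA : A.PosSemidef) (hB : B.PosSemidef)
    (hE : E.PosSemidef) (hE1 : (1 - E).PosSemidef) :
    optError ![A, B] ≤ (A * (1 - E)).trace.re + (B * E).trace.re := by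
  refine csInf_le ⟨0, ?_⟩ ⟨![E, 1 - E], ⟨posSemidef_pair hE hE1, ?_⟩, ?_⟩
  · rintro _ ⟨E, hE, rfl⟩
    exact errorProb_nonneg (posSemidef_pair hA hB) hE
  · simpa using PosSemidef.zero
  · simp [errorProb]

/-- A lower bound valid for all two-outcome tests bounds the optimal error probability. -/
theorem le_optError {A B : Matrix d d ℂ} (hB : B.PosSemidef) {c : ℝ}
    (h : ∀ E : Matrix d d ℂ, E.PosSemidef → (1 - E).PosSemidef →
      c ≤ (A * (1 - E)).trace.re + (B * E).trace.re) :
    c ≤ optError ![A, B] := by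
  refine le_csInf ⟨_, ⟨fun _ => 0, ⟨fun _ => PosSemidef.zero, ?_⟩, rfl⟩⟩ ?_
  · simpa using PosSemidef.one
  rintro _ ⟨E, hE, rfl⟩
  have h0 := hE.posSemidef 0
  have h1 := hE.posSemidef 1
  -- The POVM may be incomplete; enlarging its second outcome to `1 - E 0` can only lower the error.
  have hs : (1 - E 1 - E 0).PosSemidef := by
    have := hE.sum_le_one
    rw [Fin.sum_univ_two] at this
    convert this using 1; abel
  refine (h (E 0) h0 ?_).trans ?_
  · convert hs.add h1 using 1; abel
  · have h2 := trace_mul_nonneg hB hs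
    rw [Matrix.mul_sub B (1 - E 1), trace_sub, Complex.sub_re] at h2
    simp only [errorProb, Fin.sum_univ_two, cons_val_zero, cons_val_one]
    linarith

/-- `E - E² = E (1 - E) E + (1 - E) E (1 - E)`. -/
theorem posSemidef_sub_sq {E : Matrix d d ℂ} (hE : E.PosSemidef) (hE1 : (1 - E).PosSemidef) :
    (E - E * E).PosSemidef := by
  have h1 := hE1.mul_mul_conjTranspose_same E
  have h2 := hE.mul_mul_conjTranspose_same (1 - E)
  rw [hE.1.eq] at h1
  rw [hE1.1.eq] at h2
  convert h1.add h2 using 1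
  noncomm_ring

/-- The Nussbaum–Szkoła lower bound on the error of a two-outcome test. -/
theorem sum_min_mul_overlap_le (U V : unitaryGroup d ℂ) {l m : d → ℝ} (hl : 0 ≤ l) (hm : 0 ≤ m)
    {E : Matrix d d ℂ} (hE : E.PosSemidef) (hE1 : (1 - E).PosSemidef) :
    (1 / 2) * ∑ i, ∑ j, min (l i) (m j) * overlap U V i j ≤
      (spectralMatrix U l * (1 - E)).trace.re + (spectralMatrix V m * E).trace.re := by
  -- Replacing `1 - E` and `E` by their squares only lowers the error, and turns it into sums of
  -- squared matrix entries.
  have e1 := trace_mul_nonneg (spectralMatrix_posSemidef U hl)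
    (posSemidef_sub_sq hE1 (by simpa using hE))
  have e2 := trace_mul_nonneg (spectralMatrix_posSemidef V hm) (posSemidef_sub_sq hE hE1)
  rw [Matrix.mul_sub, trace_sub, Complex.sub_re] at e1 e2
  have f1 := trace_spectralMatrix_mul_self_conjTranspose U V l (1 - E)
  have f2 := trace_spectralMatrix_mul_conjTranspose_self U V m E
  rw [hE1.1.eq] at f1
  rw [hE.1.eq] at f2
  have key : (1 / 2) * ∑ i, ∑ j, min (l i) (m j) * overlap U V i j ≤
      (∑ i, ∑ j, l i * ‖((U : Matrix d d ℂ)ᴴ * (1 - E) * (V : Matrix d d ℂ)) i j‖ ^ 2) +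
      ∑ i, ∑ j, m j * ‖((U : Matrix d d ℂ)ᴴ * E * (V : Matrix d d ℂ)) i j‖ ^ 2 := by
    rw [Finset.mul_sum, ← Finset.sum_add_distrib]
    refine Finset.sum_le_sum fun i _ => ?_
    rw [Finset.mul_sum, ← Finset.sum_add_distrib]
    refine Finset.sum_le_sum fun j _ => ?_
    set a := ((U : Matrix d d ℂ)ᴴ * (1 - E) * (V : Matrix d d ℂ)) i j with ha
    set b := ((U : Matrix d d ℂ)ᴴ * E * (V : Matrix d d ℂ)) i j with hb
    have hab : ((U : Matrix d d ℂ)ᴴ * (V : Matrix d d ℂ)) i j = a + b := by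
      rw [ha, hb, ← Matrix.add_apply, ← Matrix.add_mul, ← Matrix.mul_add]; simp
    -- The amplitudes `a` and `b` add up to the overlap amplitude, so this is the source of the
    -- factor `1 / 2`.
    have hn : overlap U V i j ≤ 2 * (‖a‖ ^ 2 + ‖b‖ ^ 2) := by
      unfold overlap
      rw [hab]
      have h1 := norm_add_le a b
      have h2 := norm_nonneg (a + b)
      nlinarith [sq_nonneg (‖a‖ - ‖b‖)]
    have hmin : 0 ≤ min (l i) (m j) := le_min (hl i) (hm j)
    have g1 : min (l i) (m j) * ‖a‖ ^ 2 ≤ l i * ‖a‖ ^ 2 :=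
      mul_le_mul_of_nonneg_right (min_le_left _ _) (by positivity)
    have g2 : min (l i) (m j) * ‖b‖ ^ 2 ≤ m j * ‖b‖ ^ 2 :=
      mul_le_mul_of_nonneg_right (min_le_right _ _) (by positivity)
    nlinarith [mul_le_mul_of_nonneg_left hn hmin]
  linarith

end Error

/-! ### Construction of tests -/

section Tests

variable {d : Type*} [Fintype d] [DecidableEq d]

theorem trace_mul_le_trace_mul_left {A B C : Matrix d d ℂ} (hC : C.PosSemidef)
    (h : (B - A).PosSemidef) : (C * A).trace.re ≤ (C * B).trace.re := by
  have := trace_mul_nonneg hC h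
  rw [Matrix.mul_sub, trace_sub, Complex.sub_re] at this
  linarith

theorem trace_mul_le_trace_mul_right {A B C : Matrix d d ℂ} (hC : C.PosSemidef)
    (h : (B - A).PosSemidef) : (A * C).trace.re ≤ (B * C).trace.re := by
  rw [trace_mul_comm A, trace_mul_comm B]
  exact trace_mul_le_trace_mul_left hC h

/-- If `T` dominates both `A` and `B` then `Tr A - Tr A^s B^(1-s) ≤ Tr (T - B)`. -/
theorem trace_sub_chernoffQ_le {A B T : Matrix d d ℂ} (hA : A.PosSemidef) (hB : B.PosSemidef)
    (hAT : (T - A).PosSemidef) (hBT : (T - B).PosSemidef) {s : ℝ} (hs : s ∈ Set.Ioo (0 : ℝ) 1) :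
    A.trace.re - chernoffQ A B s ≤ T.trace.re - B.trace.re := by
  have hT : T.PosSemidef := by simpa using hAT.add hA
  have hu0 : 0 < 1 - s := by linarith [hs.2]
  have hu1 : 1 - s ≤ 1 := by linarith [hs.1]
  -- With `u = 1 - s`, the chain is `Tr A - Tr A^s B^u ≤ Tr A^s (T^u - B^u) ≤ Tr T^s (T^u - B^u) ≤
  -- Tr T - Tr B`. Each of `h1`, `h2`, `h3` is one inequality, from operator monotonicity.
  have h1 := trace_mul_le_trace_mul_left (supportPow_posSemidef hA s)
    (supportPow_mono hA hAT hu0 hu1)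
  have h2 := trace_mul_le_trace_mul_right (supportPow_mono hB hBT hu0 hu1)
    (supportPow_mono hA hAT hs.1 hs.2.le)
  have h3 := trace_mul_le_trace_mul_right (supportPow_posSemidef hB (1 - s))
    (supportPow_mono hB hBT hs.1 hs.2.le)
  rw [supportPow_mul_one_sub hA] at h1
  rw [Matrix.mul_sub, Matrix.mul_sub, supportPow_mul_one_sub hT, trace_sub, trace_sub,
    Complex.sub_re, Complex.sub_re] at h2
  rw [supportPow_mul_one_sub hB] at h3
  unfold chernoffQ
  linarith

/-- The Audenaert et al. inequality: the projection onto the positive part of `A - B` is a test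
with error at most `Tr A^s B^(1-s)` for every `s ∈ [0, 1]`. -/
theorem exists_projection_error_le_chernoffQ {A B : Matrix d d ℂ} (hA : A.PosSemidef)
    (hB : B.PosSemidef) : ∃ E : Matrix d d ℂ, E.PosSemidef ∧ (1 - E).PosSemidef ∧ E * E = E ∧
      ∀ s ∈ Set.Icc (0 : ℝ) 1, (A * (1 - E)).trace.re + (B * E).trace.re ≤ chernoffQ A B s := by
  have hH : (A - B).IsHermitian := hA.1.sub hB.1
  obtain ⟨U, hU⟩ := exists_eq_spectralMatrix hH
  set h := hH.eigenvalues
  set e : d → ℝ := fun i => if 0 < h i then 1 else 0 with he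
  set P := spectralMatrix U (fun i => max (h i) 0) with hP
  set N := spectralMatrix U (fun i => max (-h i) 0) with hN
  set E := spectralMatrix U e with hE
  have hPE : (A - B) * E = P := by
    rw [hU, hE, spectralMatrix_mul]
    congr 1; ext i
    simp only [he, Pi.mul_apply]
    split_ifs with hi
    · rw [mul_one, max_eq_left hi.le]
    · rw [mul_zero, max_eq_right (not_lt.mp hi)]
  have hPN : A - B = P - N := by
    rw [hU, hP, hN, spectralMatrix_sub]
    congr 1; ext i
    simp only [Pi.sub_apply]
    rcases le_total 0 (h i) with hi | hi
    · rw [max_eq_left hi, max_eq_right (by linarith)]; ring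
    · rw [max_eq_right hi, max_eq_left (by linarith)]; ring
  have hPpos : P.PosSemidef := spectralMatrix_posSemidef U fun i => le_max_right _ _
  have hNpos : N.PosSemidef := spectralMatrix_posSemidef U fun i => le_max_right _ _
  refine ⟨E, spectralMatrix_posSemidef U fun i => ?_, ?_, ?_, ?_⟩
  · simp only [he, Pi.zero_apply]; split_ifs <;> norm_num
  · rw [← spectralMatrix_one U, hE, spectralMatrix_sub]
    refine spectralMatrix_posSemidef U fun i => ?_
    simp only [he, Pi.zero_apply, Pi.sub_apply, Pi.one_apply]; split_ifs <;> norm_num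
  · rw [hE, spectralMatrix_mul]
    congr 1; ext i
    simp only [he, Pi.mul_apply]; split_ifs <;> norm_num
  · have herr : (A * (1 - E)).trace.re + (B * E).trace.re = A.trace.re - P.trace.re := by
      rw [← hPE, Matrix.mul_sub, Matrix.sub_mul, trace_sub, trace_sub, Matrix.mul_one,
        Complex.sub_re, Complex.sub_re]
      ring
    rw [herr]
    -- The dominating operator will be `T = B + P`, which equals `A + N`. Operator monotonicity is
    -- available for positive exponents only, so `s = 0` and `s = 1` are reached by closure.
    have hclosed : IsClosed {s | A.trace.re - P.trace.re ≤ chernoffQ A B s} :=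
      isClosed_le continuous_const (continuous_chernoffQ hA.1 hB.1)
    have hsub : Set.Ioo (0 : ℝ) 1 ⊆ {s | A.trace.re - P.trace.re ≤ chernoffQ A B s} := by
      intro s hs
      have hT : B + P - A = N := by
        have : B + P - A = P - (A - B) := by abel
        rw [this, hPN]; abel
      have := trace_sub_chernoffQ_le (T := B + P) hA hB (by rwa [hT]) (by simpa using hPpos) hs
      rw [trace_add, Complex.add_re] at this
      exact show A.trace.re - P.trace.re ≤ chernoffQ A B s by linarith
    have := closure_minimal hsub hclosed
    rwa [closure_Ioo zero_ne_one] at this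

open scoped MatrixOrder Matrix.Norms.L2Operator in
/-- `Y Yᴴ` and `Yᴴ Y` have the same upper bounds among scalars. -/
theorem posSemidef_smul_one_sub_mul_conjTranspose {Y : Matrix d d ℂ} {c : ℝ} (hc : 0 ≤ c)
    (h : ((c : ℂ) • (1 : Matrix d d ℂ) - Yᴴ * Y).PosSemidef) :
    ((c : ℂ) • (1 : Matrix d d ℂ) - Y * Yᴴ).PosSemidef := by
  have ealg : algebraMap ℝ (Matrix d d ℂ) c = (c : ℂ) • (1 : Matrix d d ℂ) := by
    ext i j; simp [algebraMap_matrix_apply, one_apply]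
  have h1 : star Y * Y ≤ algebraMap ℝ (Matrix d d ℂ) c := by
    rw [ealg]; exact h
  -- Both inequalities are norm bounds, and `‖Y* Y‖ = ‖Y Y*‖` by the C*-identity.
  have h2 : Y * star Y ≤ algebraMap ℝ (Matrix d d ℂ) c := by
    rw [← CStarAlgebra.norm_le_iff_le_algebraMap _ hc (mul_star_self_nonneg Y),
      CStarRing.norm_self_mul_star, ← CStarRing.norm_star_mul_self]
    exact (CStarAlgebra.norm_le_iff_le_algebraMap _ hc (star_mul_self_nonneg Y)).mpr h1
  rw [ealg] at h2
  exact h2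

/-- A projection nearly below the projection `F` accepts `B` hardly more often than `F`. -/
theorem trace_mul_le_of_conj_le {B E F : Matrix d d ℂ} (hB : B.PosSemidef) (hE : E.PosSemidef)
    (hE1 : (1 - E).PosSemidef) (hEE : E * E = E) (hF : F.PosSemidef)
    (hFF : F * F = F) {c : ℝ} (hc : 0 ≤ c)
    (h : ((c : ℂ) • (1 : Matrix d d ℂ) - E * (1 - F) * E).PosSemidef) :
    (B * E).trace.re ≤ 2 * (B * F).trace.re + 2 * (c * B.trace.re) := by
  -- Split `E = F E + (1 - F) E`: the first part satisfies `X Xᴴ = F E F ≤ F`, the second `Y Yᴴ ≤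
  -- c`.
  set X := F * E with hX
  set Y := (1 - F) * E with hY
  have hXY : X + Y = E := by rw [hX, hY, ← Matrix.add_mul]; simp
  have hNN : (1 - F) * (1 - F) = 1 - F := by
    rw [Matrix.mul_sub, Matrix.sub_mul, Matrix.sub_mul, hFF]; simp
  have hYH : Yᴴ = E * (1 - F) := by
    rw [hY, conjTranspose_mul, hE.1.eq, conjTranspose_sub, conjTranspose_one, hF.1.eq]
  have hXH : Xᴴ = E * F := by rw [hX, conjTranspose_mul, hE.1.eq, hF.1.eq]
  have hYY : ((c : ℂ) • (1 : Matrix d d ℂ) - Y * Yᴴ).PosSemidef := by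
    apply posSemidef_smul_one_sub_mul_conjTranspose hc
    rw [hYH, hY, Matrix.mul_assoc, ← Matrix.mul_assoc (1 - F), hNN, ← Matrix.mul_assoc]
    exact h
  have hXX : (F - X * Xᴴ).PosSemidef := by
    have := hE1.mul_mul_conjTranspose_same F
    rw [hF.1.eq, Matrix.mul_sub, Matrix.mul_one, Matrix.sub_mul, hFF] at this
    rw [hXH, hX, Matrix.mul_assoc, ← Matrix.mul_assoc E, hEE, ← Matrix.mul_assoc]
    exact this
  have t1 := trace_mul_le_trace_mul_left hB hXX
  have t2 := trace_mul_le_trace_mul_left hB hYY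
  have t3 := trace_mul_nonneg hB (posSemidef_self_mul_conjTranspose (X - Y))
  have hEH : E = (X + Y) * (X + Y)ᴴ := by rw [hXY, hE.1.eq, hEE]
  -- Parallelogram identity; dropping the nonnegative `X - Y` term gives `E ≤ 2 X Xᴴ + 2 Y Yᴴ` under
  -- the trace.
  have t4 : (B * E).trace.re + (B * ((X - Y) * (X - Y)ᴴ)).trace.re =
      2 * (B * (X * Xᴴ)).trace.re + 2 * (B * (Y * Yᴴ)).trace.re := by
    conv_lhs => rw [hEH]
    rw [← Complex.add_re, ← trace_add, ← Matrix.mul_add]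
    have : (X + Y) * (X + Y)ᴴ + (X - Y) * (X - Y)ᴴ = (2 : ℂ) • (X * Xᴴ) + (2 : ℂ) • (Y * Yᴴ) := by
      rw [conjTranspose_add, conjTranspose_sub, two_smul, two_smul]
      noncomm_ring
    rw [this, Matrix.mul_add, trace_add, Matrix.mul_smul, Matrix.mul_smul, trace_smul, trace_smul]
    simp
  have t5 : (B * ((c : ℂ) • (1 : Matrix d d ℂ))).trace.re = c * B.trace.re := by
    rw [Matrix.mul_smul, trace_smul, Matrix.mul_one, smul_eq_mul, Complex.re_ofReal_mul]
  linarith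

/-- Combining binary tests for `A` against each `B i` into one test for `A` against all `B i`. -/
theorem exists_common_test {ι : Type*} [Fintype ι] {A : Matrix d d ℂ} {B F : ι → Matrix d d ℂ}
    (hA : A.PosSemidef) (hB : ∀ i, (B i).PosSemidef) (hF : ∀ i, (F i).PosSemidef)
    (hF1 : ∀ i, (1 - F i).PosSemidef) (hFF : ∀ i, F i * F i = F i) {c : ℝ} (hc : 0 < c) :
    ∃ E : Matrix d d ℂ, E.PosSemidef ∧ (1 - E).PosSemidef ∧
      (A * (1 - E)).trace.re ≤ (∑ i, (A * (1 - F i)).trace.re) / c ∧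
      ∀ i, (B i * E).trace.re ≤ 2 * (B i * F i).trace.re + 2 * (c * (B i).trace.re) := by
  classical
  set N := ∑ i, (1 - F i) with hN
  have hNpos : N.PosSemidef := posSemidef_sum _ fun i _ => hF1 i
  obtain ⟨U, v, hv, hNU⟩ := exists_eq_spectralMatrix_of_posSemidef hNpos
  set e : d → ℝ := fun i => if v i ≤ c then 1 else 0 with he
  set E := spectralMatrix U e with hE
  have hEpos : E.PosSemidef := spectralMatrix_posSemidef U fun i => by
    simp only [he, Pi.zero_apply]; split_ifs <;> norm_num
  have hE1 : (1 - E).PosSemidef := by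
    rw [← spectralMatrix_one U, hE, spectralMatrix_sub]
    refine spectralMatrix_posSemidef U fun i => ?_
    simp only [he, Pi.zero_apply, Pi.sub_apply, Pi.one_apply]; split_ifs <;> norm_num
  have hEE : E * E = E := by
    rw [hE, spectralMatrix_mul]
    congr 1; ext i
    simp only [he, Pi.mul_apply]; split_ifs <;> norm_num
  have hsmul : ∀ (t : ℝ) (w : d → ℝ), (t : ℂ) • spectralMatrix U w = spectralMatrix U (t • w) := by
    intro t w
    rw [← spectralAlgHom_apply, ← spectralAlgHom_apply, map_smul]
    ext i j; simp
  refine ⟨E, hEpos, hE1, ?_, fun i => ?_⟩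
  · have h1 : (((c⁻¹ : ℝ) : ℂ) • N - (1 - E)).PosSemidef := by
      rw [← spectralMatrix_one U, hE, hNU, hsmul, spectralMatrix_sub, spectralMatrix_sub]
      refine spectralMatrix_posSemidef U fun i => ?_
      simp only [he, Pi.zero_apply, Pi.sub_apply, Pi.one_apply, Pi.smul_apply, smul_eq_mul]
      have h0 : 0 ≤ c⁻¹ * v i := mul_nonneg (by positivity) (hv i)
      split_ifs with h
      · linarith
      · have : 1 ≤ c⁻¹ * v i := by
          rw [inv_mul_eq_div, le_div_iff₀ hc]; linarith
        linarith
    have h2 := trace_mul_le_trace_mul_left hA h1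
    rw [Matrix.mul_smul, trace_smul, smul_eq_mul, Complex.re_ofReal_mul, hN, Matrix.mul_sum,
      trace_sum, Complex.re_sum, inv_mul_eq_div] at h2
    exact h2
  · refine trace_mul_le_of_conj_le (hB i) hEpos hE1 hEE (hF i) (hFF i) hc.le ?_
    -- `E (1 - F i) E ≤ E N E ≤ c`, since `1 - F i` is one summand of `N`.
    have h1 : ((c : ℂ) • (1 : Matrix d d ℂ) - E * N * E).PosSemidef := by
      rw [← spectralMatrix_one U, hE, hNU, hsmul, spectralMatrix_mul, spectralMatrix_mul,
        spectralMatrix_sub]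
      refine spectralMatrix_posSemidef U fun i => ?_
      simp only [he, Pi.zero_apply, Pi.sub_apply, Pi.one_apply, Pi.smul_apply, Pi.mul_apply,
        smul_eq_mul]
      split_ifs with h
      · linarith
      · linarith
    have h2 : (N - (1 - F i)).PosSemidef := by
      rw [hN, ← Finset.add_sum_erase _ _ (Finset.mem_univ i), add_sub_cancel_left]
      exact posSemidef_sum _ fun j _ => hF1 j
    have h3 := h2.mul_mul_conjTranspose_same E
    rw [hEpos.1.eq, Matrix.mul_sub, Matrix.sub_mul] at h3
    convert h1.add h3 using 1
    abel

/-- A test whose error for `A` against each `B i` is controlled by the Chernoff quantities. -/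
theorem exists_test_le_chernoffQMin {ι : Type*} [Fintype ι] {A : Matrix d d ℂ}
    {B : ι → Matrix d d ℂ} (hA : A.PosSemidef) (hB : ∀ i, (B i).PosSemidef) {c m : ℝ}
    (hc : 0 < c) (hm : ∀ i, ∃ s ∈ Set.Icc (0 : ℝ) 1, chernoffQ A (B i) s ≤ m) :
    ∃ E : Matrix d d ℂ, E.PosSemidef ∧ (1 - E).PosSemidef ∧
      (A * (1 - E)).trace.re ≤ Fintype.card ι * m / c ∧
      ∀ i, (B i * E).trace.re ≤ 2 * m + 2 * (c * (B i).trace.re) := by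
  choose F hF hF1 hFF hFe using fun i => exists_projection_error_le_chernoffQ hA (hB i)
  have he : ∀ i, (A * (1 - F i)).trace.re + (B i * F i).trace.re ≤ m := fun i => by
    obtain ⟨s, hs, h⟩ := hm i
    exact (hFe i s hs).trans h
  obtain ⟨E, hE, hE1, h1, h2⟩ := exists_common_test hA hB hF hF1 hFF hc
  refine ⟨E, hE, hE1, h1.trans ?_, fun i => (h2 i).trans ?_⟩
  · gcongr
    calc _ ≤ ∑ _i : ι, m := Finset.sum_le_sum fun i _ => by
          linarith [he i, trace_mul_nonneg (hB i) (hF i)]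
      _ = _ := by simp
  · linarith [he i, trace_mul_nonneg hA (hF1 i)]

end Tests

/-! ### The classical Chernoff lower bound -/

section ClassicalChernoff

/-- The last hypothesis forces `D ≤ 0`, so the product has derivative `-δ * g 0 + D < 0` at `0`.
Minimality on one side thus controls `g` on the other, even where that side leaves `[0, 1]`. -/
theorem eventually_exp_neg_mul_lt {g : ℝ → ℝ} {D δ : ℝ} (hg : HasDerivAt g D 0) (h0 : 0 < g 0)
    (hδ : 0 < δ) (h : ∀ᶠ t in 𝓝[>] (0 : ℝ), g 0 ≤ g (-t)) :
    ∀ᶠ t in 𝓝[>] (0 : ℝ), Real.exp (-(t * δ)) * g t < g 0 := by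
  have hD : D ≤ 0 := by
    have h1 : HasDerivAt (fun t => g (-t)) (-D) 0 := by
      have : HasDerivAt g D (0 - 0) := by simpa using hg
      simpa using this.comp_const_sub 0 0
    have h2 := (hasDerivAt_iff_tendsto_slope.mp h1).mono_left
      (nhdsWithin_mono (0 : ℝ) (show Set.Ioi (0 : ℝ) ⊆ {0}ᶜ from fun x hx => ne_of_gt hx))
    have h3 : 0 ≤ -D := by
      refine ge_of_tendsto h2 ?_
      filter_upwards [h, self_mem_nhdsWithin] with t ht (ht0 : 0 < t)
      rw [slope_def_field]
      simp only [neg_zero, sub_zero]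
      exact div_nonneg (by linarith) ht0.le
    linarith
  have he : HasDerivAt (fun t => Real.exp (-(t * δ))) (-δ) 0 := by
    simpa using (((hasDerivAt_id (0 : ℝ)).mul_const δ).fun_neg).exp
  have h1 := he.fun_mul hg
  simp only [zero_mul, neg_zero, Real.exp_zero, one_mul] at h1
  have h2 := (hasDerivAt_iff_tendsto_slope.mp h1).mono_left
    (nhdsWithin_mono (0 : ℝ) (show Set.Ioi (0 : ℝ) ⊆ {0}ᶜ from fun x hx => ne_of_gt hx))
  have h3 : -δ * g 0 + D < 0 := by nlinarith
  filter_upwards [h2.eventually_lt_const h3, self_mem_nhdsWithin] with t ht (ht0 : 0 < t)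
  rw [slope_def_field, div_lt_iff₀ (by simpa using ht0)] at ht
  simp only [zero_mul, neg_zero, Real.exp_zero, one_mul] at ht
  linarith

/-- For `|S| ≤ δ` the main term alone suffices. For `S > δ` the `kp` correction makes the bracket
nonpositive, and for `S < -δ` the `km` correction does. At `s = 0`, resp. `s = 1`, the main term
suffices there too, so that correction can be switched off. Averaging this pointwise bound replaces
a concentration argument under the tilted measure. -/
theorem exp_neg_mul_le_min {s δ t S kp km : ℝ} (hs : s ∈ Set.Icc (0 : ℝ) 1) (hδ : 0 ≤ δ)
    (ht : 0 ≤ t) (hkp : 0 ≤ kp) (hkm : 0 ≤ km) (hp : s = 0 ∨ 1 ≤ kp) (hm : s = 1 ∨ 1 ≤ km) :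
    Real.exp (-δ) * (Real.exp (s * S) - kp * (Real.exp (-(t * δ)) * Real.exp ((s + t) * S)) -
      km * (Real.exp (-(t * δ)) * Real.exp ((s - t) * S))) ≤ min (Real.exp S) 1 := by
  obtain ⟨hs0, hs1⟩ := hs
  have hmin : 0 ≤ min (Real.exp S) 1 := le_min (Real.exp_pos _).le zero_le_one
  have hA : 0 ≤ kp * (Real.exp (-(t * δ)) * Real.exp ((s + t) * S)) := by positivity
  have hB : 0 ≤ km * (Real.exp (-(t * δ)) * Real.exp ((s - t) * S)) := by positivity
  have hbound : ∀ h : Real.exp (-δ) * Real.exp (s * S) ≤ min (Real.exp S) 1,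
      Real.exp (-δ) * (Real.exp (s * S) - kp * (Real.exp (-(t * δ)) * Real.exp ((s + t) * S)) -
      km * (Real.exp (-(t * δ)) * Real.exp ((s - t) * S))) ≤ min (Real.exp S) 1 := fun h =>
    (mul_le_mul_of_nonneg_left (by linarith) (Real.exp_pos _).le).trans h
  have hzero : ∀ h : Real.exp (s * S) - kp * (Real.exp (-(t * δ)) * Real.exp ((s + t) * S)) -
      km * (Real.exp (-(t * δ)) * Real.exp ((s - t) * S)) ≤ 0,
      Real.exp (-δ) * (Real.exp (s * S) - kp * (Real.exp (-(t * δ)) * Real.exp ((s + t) * S)) -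
      km * (Real.exp (-(t * δ)) * Real.exp ((s - t) * S))) ≤ min (Real.exp S) 1 := fun h =>
    (mul_nonpos_of_nonneg_of_nonpos (Real.exp_pos _).le h).trans hmin
  rcases lt_or_ge δ S with h1 | h1
  · rcases hp with rfl | hp
    · apply hbound
      rw [← Real.exp_add]
      refine le_min (Real.exp_le_exp.mpr (by linarith)) (Real.exp_le_one_iff.mpr (by linarith))
    · apply hzero
      have : Real.exp (s * S) ≤ Real.exp (-(t * δ)) * Real.exp ((s + t) * S) := by
        rw [← Real.exp_add]
        exact Real.exp_le_exp.mpr (by nlinarith)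
      have : Real.exp (s * S) ≤ kp * (Real.exp (-(t * δ)) * Real.exp ((s + t) * S)) :=
        this.trans (le_mul_of_one_le_left (by positivity) hp)
      linarith
  rcases lt_or_ge S (-δ) with h2 | h2
  · rcases hm with rfl | hm
    · apply hbound
      rw [← Real.exp_add]
      refine le_min (Real.exp_le_exp.mpr (by linarith)) (Real.exp_le_one_iff.mpr (by linarith))
    · apply hzero
      have : Real.exp (s * S) ≤ Real.exp (-(t * δ)) * Real.exp ((s - t) * S) := by
        rw [← Real.exp_add]
        exact Real.exp_le_exp.mpr (by nlinarith)
      have : Real.exp (s * S) ≤ km * (Real.exp (-(t * δ)) * Real.exp ((s - t) * S)) :=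
        this.trans (le_mul_of_one_le_left (by positivity) hm)
      linarith
  · apply hbound
    rw [← Real.exp_add]
    refine le_min (Real.exp_le_exp.mpr ?_) (Real.exp_le_one_iff.mpr ?_)
    · nlinarith
    · nlinarith

/-- Chernoff's lower bound for i.i.d. sums, with `β` the reference weights and `L` the
log-likelihood ratio. -/
theorem eventually_le_sum_prod_mul_min {X : Type*} [Fintype X] {β L : X → ℝ} (hβ : ∀ x, 0 ≤ β x)
    {M δ : ℝ} (hM : 0 < M) (hδ : 0 < δ)
    (hZ : ∀ s ∈ Set.Icc (0 : ℝ) 1, M ≤ ∑ x, β x * Real.exp (s * L x)) :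
    ∀ᶠ n : ℕ in atTop, (1 / 2) * (M * Real.exp (-δ)) ^ n ≤
      ∑ x : Fin n → X, (∏ k, β (x k)) * min (Real.exp (∑ k, L (x k))) 1 := by
  classical
  set Z : ℝ → ℝ := fun s => ∑ x, β x * Real.exp (s * L x) with hZdef
  have hZdiff : Differentiable ℝ Z := by
    rw [hZdef]; fun_prop
  have hZ0 : ∀ s, 0 ≤ Z s := fun s =>
    Finset.sum_nonneg fun x _ => mul_nonneg (hβ x) (Real.exp_pos _).le
  obtain ⟨s, hs, hmin⟩ := isCompact_Icc.exists_isMinOn (Set.nonempty_Icc.mpr zero_le_one)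
    hZdiff.continuous.continuousOn (f := Z) (s := Set.Icc (0 : ℝ) 1)
  have hMs : M ≤ Z s := hZ s hs
  have hZs : 0 < Z s := hM.trans_le hMs
  have hd := (hZdiff s).hasDerivAt
  have hplus : s ≠ 0 → ∀ᶠ t in 𝓝[>] (0 : ℝ), Real.exp (-(t * δ)) * Z (s + t) < Z s := by
    intro hs0
    have hpos : 0 < s := lt_of_le_of_ne hs.1 (Ne.symm hs0)
    have h := eventually_exp_neg_mul_lt (g := fun t => Z (s + t)) (D := deriv Z s) (δ := δ)
      (by
        have : HasDerivAt Z (deriv Z s) (s + 0) := by simpa using hd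
        exact this.comp_const_add s 0) (by simpa using hZs) hδ (by
          filter_upwards [Ioo_mem_nhdsGT hpos] with t ht
          have : s + -t ∈ Set.Icc (0 : ℝ) 1 := ⟨by linarith [ht.2], by linarith [ht.1, hs.2]⟩
          simpa using hmin this)
    simpa using h
  have hminus : s ≠ 1 → ∀ᶠ t in 𝓝[>] (0 : ℝ), Real.exp (-(t * δ)) * Z (s - t) < Z s := by
    intro hs1
    have hpos : 0 < 1 - s := by linarith [lt_of_le_of_ne hs.2 hs1]
    have h := eventually_exp_neg_mul_lt (g := fun t => Z (s - t)) (D := -deriv Z s) (δ := δ)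
      (by
        have : HasDerivAt Z (deriv Z s) (s - 0) := by simpa using hd
        exact this.comp_const_sub s 0) (by simpa using hZs) hδ (by
          filter_upwards [Ioo_mem_nhdsGT hpos] with t ht
          have : s + t ∈ Set.Icc (0 : ℝ) 1 := ⟨by linarith [ht.1, hs.1], by linarith [ht.2]⟩
          simpa using hmin this)
    simpa using h
  -- At an endpoint minimizer, one of the one-sided derivative bounds is missing; the matching
  -- correction is removed.
  set kp : ℝ := if s = 0 then 0 else 1 with hkp
  set km : ℝ := if s = 1 then 0 else 1 with hkm
  have hkp0 : 0 ≤ kp := by rw [hkp]; split_ifs <;> norm_num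
  have hkm0 : 0 ≤ km := by rw [hkm]; split_ifs <;> norm_num
  have hkp1 : s = 0 ∨ 1 ≤ kp := by by_cases h : s = 0 <;> simp [hkp, h]
  have hkm1 : s = 1 ∨ 1 ≤ km := by by_cases h : s = 1 <;> simp [hkm, h]
  obtain ⟨t, ht1, ht2, ht0⟩ : ∃ t, (kp * (Real.exp (-(t * δ)) * Z (s + t)) < Z s) ∧
      (km * (Real.exp (-(t * δ)) * Z (s - t)) < Z s) ∧ 0 < t := by
    have h1 : ∀ᶠ t in 𝓝[>] (0 : ℝ), kp * (Real.exp (-(t * δ)) * Z (s + t)) < Z s := by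
      by_cases h : s = 0
      · filter_upwards with t
        simpa [hkp, h] using h ▸ hZs
      · simpa [hkp, h] using hplus h
    have h2 : ∀ᶠ t in 𝓝[>] (0 : ℝ), km * (Real.exp (-(t * δ)) * Z (s - t)) < Z s := by
      by_cases h : s = 1
      · filter_upwards with t
        simpa [hkm, h] using h ▸ hZs
      · simpa [hkm, h] using hminus h
    exact (h1.and (h2.and self_mem_nhdsWithin)).exists
  have hpow : ∀ (n : ℕ) (u : ℝ),
      ∑ x : Fin n → X, (∏ k, β (x k)) * Real.exp (u * ∑ k, L (x k)) = Z u ^ n := by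
    intro n u
    rw [hZdef, Fintype.sum_pow]
    refine Finset.sum_congr rfl fun x _ => ?_
    rw [Finset.prod_mul_distrib, ← Real.exp_sum, Finset.mul_sum]
  -- Each correction is eventually at most a quarter of the main term, which leaves the factor `1 /
  -- 2`.
  have hlim : ∀ k y : ℝ, 0 ≤ k → (k = 0 ∨ k = 1) → 0 ≤ y → k * y < Z s →
      ∀ᶠ n : ℕ in atTop, k * y ^ n ≤ (1 / 4) * Z s ^ n := by
    intro k y hk0 hk hy hlt
    rcases hk with rfl | rfl
    · filter_upwards with n
      have := pow_pos hZs n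
      linarith
    · rw [one_mul] at hlt
      have h := tendsto_pow_atTop_nhds_zero_of_lt_one (div_nonneg hy hZs.le)
        ((div_lt_one hZs).mpr hlt)
      filter_upwards [h.eventually_lt_const (show (0 : ℝ) < 1 / 4 by norm_num)] with n hn
      rw [div_pow, div_lt_iff₀ (pow_pos hZs n)] at hn
      linarith
  filter_upwards [hlim kp (Real.exp (-(t * δ)) * Z (s + t)) hkp0
      (by rw [hkp]; split_ifs <;> simp) (mul_nonneg (Real.exp_pos _).le (hZ0 _)) ht1,
    hlim km (Real.exp (-(t * δ)) * Z (s - t)) hkm0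
      (by rw [hkm]; split_ifs <;> simp) (mul_nonneg (Real.exp_pos _).le (hZ0 _)) ht2]
    with n hn1 hn2
  have hexp : ∀ a : ℝ, Real.exp a ^ n = Real.exp (n * a) := fun a => (Real.exp_nat_mul a n).symm
  have hMn : M ^ n ≤ Z s ^ n := pow_le_pow_left₀ hM.le hMs n
  calc (1 / 2) * (M * Real.exp (-δ)) ^ n
      = Real.exp (-δ) ^ n * ((1 / 2) * M ^ n) := by rw [mul_pow]; ring
    _ ≤ Real.exp (-δ) ^ n * (Z s ^ n - kp * (Real.exp (-(t * δ)) * Z (s + t)) ^ n -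
          km * (Real.exp (-(t * δ)) * Z (s - t)) ^ n) :=
        mul_le_mul_of_nonneg_left (by linarith) (by positivity)
    _ = ∑ x : Fin n → X, (∏ k, β (x k)) * (Real.exp (-(n * δ)) *
          (Real.exp (s * ∑ k, L (x k)) -
            kp * (Real.exp (-(t * (n * δ))) * Real.exp ((s + t) * ∑ k, L (x k))) -
            km * (Real.exp (-(t * (n * δ))) * Real.exp ((s - t) * ∑ k, L (x k))))) := by
        rw [mul_pow, mul_pow, hexp, hexp, ← hpow n s, ← hpow n (s + t), ← hpow n (s - t)]
        simp only [Finset.mul_sum, ← Finset.sum_sub_distrib]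
        refine Finset.sum_congr rfl fun x _ => ?_
        have e1 : (n : ℝ) * -δ = -(n * δ) := by ring
        have e2 : (n : ℝ) * -(t * δ) = -(t * (n * δ)) := by ring
        rw [e1, e2]
        ring
    -- The pointwise bound is used with `n * δ` in place of `δ`.
    _ ≤ _ := Finset.sum_le_sum fun x _ => mul_le_mul_of_nonneg_left
        (exp_neg_mul_le_min hs (by positivity) ht0.le hkp0 hkm0 hkp1 hkm1)
        (Finset.prod_nonneg fun k _ => hβ _)

end ClassicalChernoff

/-! ### Bounds on the optimal error of the i.i.d. problem -/

section QuantumBounds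

variable {d : Type*} [Fintype d] [DecidableEq d]

theorem trace_tensorPow_mul_re {A B : Matrix d d ℂ} (hA : A.PosSemidef) (hB : B.PosSemidef)
    (n : ℕ) : (tensorPow A n * tensorPow B n).trace.re = (A * B).trace.re ^ n := by
  obtain ⟨U, l, hl, rfl⟩ := exists_eq_spectralMatrix_of_posSemidef hA
  obtain ⟨V, m, hm, rfl⟩ := exists_eq_spectralMatrix_of_posSemidef hB
  rw [tensorPow_spectralMatrix, tensorPow_spectralMatrix, trace_spectralMatrix_mul,
    trace_spectralMatrix_mul, ← sum_sum_prod_eq_pow]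
  refine Finset.sum_congr rfl fun x _ => Finset.sum_congr rfl fun y _ => ?_
  rw [overlap_tensorUnitary, ← Finset.prod_mul_distrib, ← Finset.prod_mul_distrib]

/-- Every test between `ρ^{⊗n}` and `σ^{⊗n}` has error at least `e^{-n(C + δ)} / 4` eventually. -/
theorem eventually_le_error_tensorPow {ρ σ : Matrix d d ℂ} (hρ : ρ.PosSemidef)
    (hσ : σ.PosSemidef) {δ : ℝ} (hδ : 0 < δ) (hM : 0 < chernoffQMin ρ σ) :
    ∀ᶠ n : ℕ in atTop, ∀ E : Matrix (Fin n → d) (Fin n → d) ℂ, E.PosSemidef →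
      (1 - E).PosSemidef → (1 / 4) * (chernoffQMin ρ σ * Real.exp (-δ)) ^ n ≤
        (tensorPow ρ n * (1 - E)).trace.re + (tensorPow σ n * E).trace.re := by
  have hbdd := bddBelow_chernoffQ hρ hσ
  have hQ : ∀ s ∈ Set.Icc (0 : ℝ) 1, chernoffQMin ρ σ ≤ chernoffQ ρ σ s :=
    fun s hs => csInf_le hbdd ⟨s, hs, rfl⟩
  obtain ⟨U, l, hl, rfl⟩ := exists_eq_spectralMatrix_of_posSemidef hρ
  obtain ⟨V, m, hm, rfl⟩ := exists_eq_spectralMatrix_of_posSemidef hσ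
  set M := chernoffQMin (spectralMatrix U l) (spectralMatrix V m)
  -- Pairs with a zero eigenvalue get weight `0`; on the others `β z * exp (s * L z)` is the summand
  -- of `chernoffQ` at `s`.
  set β : d × d → ℝ := fun z =>
    if 0 < l z.1 ∧ 0 < m z.2 then m z.2 * overlap U V z.1 z.2 else 0 with hβ
  set L : d × d → ℝ := fun z => Real.log (l z.1 / m z.2) with hL
  have hβ0 : ∀ z, 0 ≤ β z := fun z => by
    simp only [hβ]; split_ifs with h
    · exact mul_nonneg h.2.le (overlap_nonneg U V _ _)
    · rfl
  have hZ : ∀ s ∈ Set.Icc (0 : ℝ) 1, M ≤ ∑ z, β z * Real.exp (s * L z) := by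
    intro s hs
    refine (hQ s hs).trans_eq ?_
    rw [chernoffQ_spectralMatrix, Fintype.sum_prod_type]
    refine Finset.sum_congr rfl fun i _ => Finset.sum_congr rfl fun j _ => ?_
    simp only [hβ, hL]
    rcases (hl i).eq_or_lt with h | h
    · simp [← h, supportRpow]
    rcases (hm j).eq_or_lt with h' | h'
    · simp [← h', supportRpow]
    have h : 0 < l i := h
    have h' : 0 < m j := h'
    rw [if_pos ⟨h, h'⟩, supportRpow, supportRpow, if_neg h.ne', if_neg h'.ne',
      Real.rpow_sub h', Real.rpow_one, mul_comm s, ← Real.rpow_def_of_pos (div_pos h h'),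
      Real.div_rpow h.le h'.le]
    ring
  filter_upwards [eventually_le_sum_prod_mul_min hβ0 hM hδ hZ] with n hn E hE hE1
  rw [tensorPow_spectralMatrix, tensorPow_spectralMatrix]
  refine le_trans ?_ (sum_min_mul_overlap_le (tensorUnitary U n) (tensorUnitary V n)
    (fun x => Finset.prod_nonneg fun k _ => hl _)
    (fun x => Finset.prod_nonneg fun k _ => hm _) hE hE1)
  have key : ∑ z : Fin n → d × d, (∏ k, β (z k)) * min (Real.exp (∑ k, L (z k))) 1 ≤
      ∑ x : Fin n → d, ∑ y : Fin n → d, min (∏ k, l (x k)) (∏ k, m (y k)) *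
        overlap (tensorUnitary U n) (tensorUnitary V n) x y := by
    rw [← Fintype.sum_prod_type', ← (Equiv.arrowProdEquivProdArrow (Fin n) (fun _ => d)
      (fun _ => d)).sum_comp]
    refine Finset.sum_le_sum fun z _ => ?_
    simp only [Equiv.arrowProdEquivProdArrow, Equiv.coe_fn_mk, overlap_tensorUnitary]
    by_cases hz : ∀ k, 0 < l (z k).1 ∧ 0 < m (z k).2
    · have hlp : 0 < ∏ k, l (z k).1 := Finset.prod_pos fun k _ => (hz k).1
      have hmp : 0 < ∏ k, m (z k).2 := Finset.prod_pos fun k _ => (hz k).2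
      have e1 : ∏ k, β (z k) = (∏ k, m (z k).2) * ∏ k, overlap U V (z k).1 (z k).2 := by
        rw [← Finset.prod_mul_distrib]
        exact Finset.prod_congr rfl fun k _ => if_pos (hz k)
      have e2 : Real.exp (∑ k, L (z k)) = (∏ k, l (z k).1) / ∏ k, m (z k).2 := by
        rw [Real.exp_sum, ← Finset.prod_div_distrib]
        exact Finset.prod_congr rfl fun k _ => Real.exp_log (div_pos (hz k).1 (hz k).2)
      rw [e1, e2, mul_right_comm, mul_min_of_nonneg _ _ hmp.le, mul_div_cancel₀ _ hmp.ne',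
        mul_one]
    · push Not at hz
      obtain ⟨k, hk⟩ := hz
      rw [Finset.prod_eq_zero (Finset.mem_univ k)
        (if_neg (fun h => absurd h.2 (not_lt.mpr (hk h.1)))), zero_mul]
      exact mul_nonneg (le_min (Finset.prod_nonneg fun k _ => hl _)
        (Finset.prod_nonneg fun k _ => hm _)) (Finset.prod_nonneg fun k _ => overlap_nonneg U V _ _)
  -- The constant `1 / 4` is `1 / 2` from Nussbaum–Szkoła times `1 / 2` from Chernoff.
  linarith

theorem posSemidef_ofReal_smul {d : Type*} {A : Matrix d d ℂ} (hA : A.PosSemidef) {t : ℝ} (ht : 0 ≤ t) :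
    ((t : ℂ) • A).PosSemidef :=
  hA.smul (by exact_mod_cast ht)

theorem trace_ofReal_smul_mul {d : Type*} [Fintype d] (t : ℝ) (A B : Matrix d d ℂ) :
    (((t : ℂ) • A) * B).trace.re = t * (A * B).trace.re := by
  rw [Matrix.smul_mul, trace_smul, smul_eq_mul, Complex.re_ofReal_mul]

variable {r : ℕ} {p : ℝ} {q : Fin r → ℝ} {ρ : Matrix d d ℂ} {σ : Fin r → Matrix d d ℂ}

theorem iidHyp_posSemidef (hp0 : 0 ≤ p) (hρ : ρ.PosSemidef) (n : ℕ) :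
    (iidHyp p ρ n).PosSemidef :=
  posSemidef_ofReal_smul (posSemidef_tensorPow hρ n) hp0

theorem avgIidHyp_posSemidef (hp1 : p ≤ 1) (hq : ∀ i, 0 ≤ q i) (hσ : ∀ i, (σ i).PosSemidef)
    (n : ℕ) : (avgIidHyp p q σ n).PosSemidef :=
  posSemidef_ofReal_smul (posSemidef_sum _ fun i _ =>
    posSemidef_ofReal_smul (posSemidef_tensorPow (hσ i) n) (hq i)) (by linarith)

theorem trace_avgIidHyp_mul {d : Type*} [Fintype d] {σ : Fin r → Matrix d d ℂ} (n : ℕ) (E : Matrix (Fin n → d) (Fin n → d) ℂ) :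
    (avgIidHyp p q σ n * E).trace.re =
      (1 - p) * ∑ i, q i * (tensorPow (σ i) n * E).trace.re := by
  rw [avgIidHyp, trace_ofReal_smul_mul, Matrix.sum_mul, trace_sum, Complex.re_sum]
  simp only [trace_ofReal_smul_mul]

theorem trace_avgIidHyp_mul_le (hp0 : 0 ≤ p) (hp1 : p ≤ 1) (hq : ∀ i, 0 ≤ q i)
    (hqsum : ∑ i, q i = 1) {n : ℕ} {E : Matrix (Fin n → d) (Fin n → d) ℂ} {c : ℝ} (hc : 0 ≤ c)
    (h : ∀ i, (tensorPow (σ i) n * E).trace.re ≤ c) : (avgIidHyp p q σ n * E).trace.re ≤ c := by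
  rw [trace_avgIidHyp_mul]
  have h1 : ∑ i, q i * (tensorPow (σ i) n * E).trace.re ≤ c :=
    calc _ ≤ ∑ i, q i * c := Finset.sum_le_sum fun i _ => mul_le_mul_of_nonneg_left (h i) (hq i)
      _ = c := by rw [← Finset.sum_mul, hqsum, one_mul]
  nlinarith

theorem optError_iid_nonneg (hp0 : 0 < p) (hp1 : p < 1) (hq : ∀ i, 0 < q i)
    (hρ : ρ.PosSemidef) (hσ : ∀ i, (σ i).PosSemidef) (n : ℕ) :
    0 ≤ optError ![iidHyp p ρ n, avgIidHyp p q σ n] :=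
  optError_nonneg (iidHyp_posSemidef hp0.le hρ n)
    (avgIidHyp_posSemidef hp1.le (fun i => (hq i).le) hσ n)

/-- All hypotheses `σ j` with `j ≠ i` are dropped from the average; the priors only affect the
constant. -/
theorem eventually_le_optError (hp0 : 0 < p) (hp1 : p < 1) (hq : ∀ i, 0 < q i)
    (hρ : ρ.PosSemidef) (hσ : ∀ i, (σ i).PosSemidef) (i : Fin r) {δ : ℝ} (hδ : 0 < δ)
    (hM : 0 < chernoffQMin ρ (σ i)) :
    ∀ᶠ n : ℕ in atTop, (min p ((1 - p) * q i) / 4) * (chernoffQMin ρ (σ i) * Real.exp (-δ)) ^ n ≤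
      optError ![iidHyp p ρ n, avgIidHyp p q σ n] := by
  filter_upwards [eventually_le_error_tensorPow hρ (hσ i) hδ hM] with n hn
  refine le_optError (avgIidHyp_posSemidef hp1.le (fun i => (hq i).le) hσ n) fun E hE hE1 => ?_
  have h := hn E hE hE1
  have ha := trace_mul_nonneg (posSemidef_tensorPow hρ n) hE1
  have hb := fun j => trace_mul_nonneg (posSemidef_tensorPow (hσ j) n) hE
  rw [iidHyp, trace_ofReal_smul_mul, trace_avgIidHyp_mul]
  have h1 : q i * (tensorPow (σ i) n * E).trace.re ≤
      ∑ j, q j * (tensorPow (σ j) n * E).trace.re :=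
    Finset.single_le_sum (f := fun j => q j * (tensorPow (σ j) n * E).trace.re)
      (fun j _ => mul_nonneg (hq j).le (hb j)) (Finset.mem_univ i)
  have h2 := mul_le_mul_of_nonneg_left h1 (show 0 ≤ 1 - p by linarith)
  set k := min p ((1 - p) * q i) with hk
  have hk0 : 0 ≤ k := le_min hp0.le (mul_nonneg (by linarith) (hq i).le)
  have h3 : k * (tensorPow ρ n * (1 - E)).trace.re ≤ p * (tensorPow ρ n * (1 - E)).trace.re :=
    mul_le_mul_of_nonneg_right (min_le_left _ _) ha
  have h4 : k * (tensorPow (σ i) n * E).trace.re ≤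
      (1 - p) * q i * (tensorPow (σ i) n * E).trace.re :=
    mul_le_mul_of_nonneg_right (min_le_right _ _) (hb i)
  have h5 := mul_le_mul_of_nonneg_left h hk0
  linarith

theorem optError_le_mul_sqrt_pow (hp0 : 0 < p) (hp1 : p < 1) (hq : ∀ i, 0 < q i)
    (hqsum : ∑ i, q i = 1) (hρ : IsState ρ) (hσ : ∀ i, IsState (σ i)) {M : ℝ} (hM0 : 0 ≤ M)
    (hM1 : M ≤ 1) (hM : ∀ i, chernoffQMin ρ (σ i) ≤ M) {n : ℕ} (hn : n ≠ 0) :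
    optError ![iidHyp p ρ n, avgIidHyp p q σ n] ≤ (r + 4) * Real.sqrt M ^ n := by
  have hm0 : 0 ≤ M ^ n := pow_nonneg hM0 n
  have hbound : ∀ c : ℝ, 0 < c → optError ![iidHyp p ρ n, avgIidHyp p q σ n] ≤
      r * M ^ n / c + (2 * M ^ n + 2 * c) := by
    intro c hc
    obtain ⟨E, hE, hE1, h1, h2⟩ := exists_test_le_chernoffQMin (m := M ^ n)
      (posSemidef_tensorPow hρ.posSemidef n)
      (fun i => posSemidef_tensorPow (hσ i).posSemidef n) hc (fun i => by
        obtain ⟨s, hs, h, -⟩ := exists_chernoffQMin_eq hρ.posSemidef (hσ i).posSemidef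
        refine ⟨s, hs, ?_⟩
        rw [chernoffQ_tensorPow hρ.posSemidef (hσ i).posSemidef]
        exact pow_le_pow_left₀ (chernoffQ_nonneg hρ.posSemidef (hσ i).posSemidef s)
          (h ▸ hM i) n)
    refine (optError_le (iidHyp_posSemidef hp0.le hρ.posSemidef n)
      (avgIidHyp_posSemidef hp1.le (fun i => (hq i).le) (fun i => (hσ i).posSemidef) n)
      hE hE1).trans (add_le_add ?_ ?_)
    · rw [iidHyp, trace_ofReal_smul_mul]
      rw [Fintype.card_fin] at h1
      have h3 := trace_mul_nonneg (posSemidef_tensorPow hρ.posSemidef n) hE1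
      nlinarith
    · refine trace_avgIidHyp_mul_le hp0.le hp1.le (fun i => (hq i).le) hqsum
        (by positivity) fun i => (h2 i).trans_eq ?_
      rw [trace_tensorPow, (hσ i).trace_eq_one]
      simp
  -- If `M = 0`, the balanced `c` would vanish, so `c` is sent to `0` instead.
  rcases hM0.eq_or_lt with h | h
  · rw [← h, zero_pow hn] at hbound
    rw [← h, Real.sqrt_zero, zero_pow hn, mul_zero]
    refine le_of_forall_pos_le_add fun ε hε => ?_
    have := hbound (ε / 2) (by positivity)
    simp only [mul_zero, zero_div, zero_add] at this ⊢
    linarith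
  -- With `c = x`, the bound is `r x + 2 x² + 2 x ≤ (r + 4) x`, because `x ≤ 1`.
  · set x := Real.sqrt M ^ n with hx
    have hx0 : 0 < x := pow_pos (Real.sqrt_pos.mpr h) n
    have hx1 : x ≤ 1 := pow_le_one₀ (Real.sqrt_nonneg M) (Real.sqrt_le_one.mpr hM1)
    have hxx : M ^ n = x * x := by rw [hx, ← mul_pow, Real.mul_self_sqrt hM0]
    have := hbound x hx0
    rw [hxx, mul_div_assoc, mul_div_cancel_right₀ _ hx0.ne'] at this
    nlinarith

theorem IsPure.mul_self {d : Type*} [Fintype d] {ρ : Matrix d d ℂ} (hρ : IsState ρ) (hpure : IsPure ρ) : ρ * ρ = ρ := by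
  obtain ⟨ψ, rfl⟩ := hpure
  have h := hρ.trace_eq_one
  rw [trace_vecMulVec] at h
  rw [vecMulVec_mul_vecMulVec, dotProduct_comm, h, one_smul]

theorem optError_le_pow_of_isPure (hp0 : 0 < p) (hp1 : p < 1) (hq : ∀ i, 0 < q i)
    (hqsum : ∑ i, q i = 1) (hρ : IsState ρ) (hσ : ∀ i, IsState (σ i)) (hpure : IsPure ρ)
    {M : ℝ} (hM0 : 0 ≤ M) (hM : ∀ i, chernoffQMin ρ (σ i) ≤ M) (n : ℕ) :
    optError ![iidHyp p ρ n, avgIidHyp p q σ n] ≤ M ^ n := by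
  have hE := posSemidef_tensorPow hρ.posSemidef n
  have hEE : tensorPow ρ n * tensorPow ρ n = tensorPow ρ n := by
    rw [← tensorPow_mul, hpure.mul_self hρ]
  have hE1 : (1 - tensorPow ρ n).PosSemidef := by
    have := posSemidef_self_mul_conjTranspose (1 - tensorPow ρ n)
    rw [conjTranspose_sub, conjTranspose_one, hE.1.eq, Matrix.mul_sub,
      Matrix.mul_one, Matrix.sub_mul, hEE, Matrix.one_mul, sub_self, sub_zero] at this
    exact this
  refine (optError_le (iidHyp_posSemidef hp0.le hρ.posSemidef n)
    (avgIidHyp_posSemidef hp1.le (fun i => (hq i).le) (fun i => (hσ i).posSemidef) n)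
    hE hE1).trans ?_
  rw [iidHyp, trace_ofReal_smul_mul, Matrix.mul_sub, hEE, Matrix.mul_one, sub_self, trace_zero,
    Complex.zero_re, mul_zero, zero_add]
  refine trace_avgIidHyp_mul_le hp0.le hp1.le (fun i => (hq i).le) hqsum (pow_nonneg hM0 n)
    fun i => ?_
  rw [trace_tensorPow_mul_re (hσ i).posSemidef hρ.posSemidef]
  refine pow_le_pow_left₀ (trace_mul_nonneg (hσ i).posSemidef hρ.posSemidef) ?_ n
  rw [trace_mul_comm]
  exact (trace_mul_le_chernoffQMin hρ (hσ i)).trans (hM i)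

end QuantumBounds

/-! ### Passage to exponential rates -/

section Asymptotics

variable {d : Type*} [Fintype d] [DecidableEq d] {b : ℝ}

theorem extLog_mono (hb : 1 < b) {x y : ℝ} (hx : 0 ≤ x) (hxy : x ≤ y) :
    extLog b x ≤ extLog b y := by
  rcases hx.eq_or_lt with h | h
  · simp [extLog, ← h]
  · rw [extLog, extLog, if_neg h.ne', if_neg (h.trans_le hxy).ne']
    exact_mod_cast Real.logb_le_logb_of_le hb h hxy

theorem extLog_of_pos {x : ℝ} (hx : 0 < x) : extLog b x = (Real.logb b x : ℝ) :=
  if_neg hx.ne'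

theorem extLog_zero : extLog b 0 = ⊥ := if_pos rfl

theorem extLog_sqrt {x : ℝ} (hx : 0 ≤ x) :
    extLog b (Real.sqrt x) = -(((1 / 2 : ℝ) : EReal) * -extLog b x) := by
  rcases hx.eq_or_lt with h | h
  · rw [← h, Real.sqrt_zero, extLog_zero, EReal.neg_bot, EReal.coe_mul_top_of_pos (by norm_num),
      EReal.neg_top]
  · rw [extLog_of_pos h, extLog_of_pos (Real.sqrt_pos.mpr h), ← EReal.coe_neg, ← EReal.coe_mul,
      ← EReal.coe_neg, Real.logb, Real.logb, Real.log_sqrt hx]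
    congr 1
    ring

theorem extLog_geometric {K m : ℝ} (hK : 0 < K) (hm : 0 < m) {n : ℕ} (hn : n ≠ 0) :
    ((1 / (n : ℝ) : ℝ) : EReal) * extLog b (K * m ^ n) =
      ((Real.logb b K / n + Real.logb b m : ℝ) : EReal) := by
  rw [extLog_of_pos (by positivity), ← EReal.coe_mul, Real.logb_mul hK.ne' (by positivity),
    Real.logb_pow]
  congr 1
  have : (n : ℝ) ≠ 0 := by exact_mod_cast hn
  field_simp

theorem tendsto_logb_geometric (K m : ℝ) :
    Tendsto (fun n : ℕ => ((Real.logb b K / n + Real.logb b m : ℝ) : EReal)) atTop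
      (𝓝 (Real.logb b m : ℝ)) := by
  refine (continuous_coe_real_ereal.tendsto _).comp ?_
  simpa using (tendsto_const_div_atTop_nhds_zero_nat (Real.logb b K)).add_const (Real.logb b m)

theorem limsup_rate_le (hb : 1 < b) {e : ℕ → ℝ} {K m : ℝ} (hK : 0 < K) (hm : 0 ≤ m)
    (he0 : ∀ n, 0 ≤ e n) (he : ∀ n, n ≠ 0 → e n ≤ K * m ^ n) :
    limsup (fun n : ℕ => ((1 / (n : ℝ) : ℝ) : EReal) * extLog b (e n)) atTop ≤ extLog b m := by
  rcases hm.eq_or_lt with h | h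
  · rw [← h, extLog_zero]
    -- With `m = 0` the error vanishes for every `n ≠ 0`, so the rate is `⊥`; `n = 0` is excluded
    -- because `0 ^ 0 = 1`.
    refine limsup_le_of_le (h := ?_)
    filter_upwards [eventually_ne_atTop 0] with n hn
    have h0 : e n = 0 := le_antisymm (by simpa [← h, hn] using he n hn) (he0 n)
    rw [h0, extLog_zero, EReal.coe_mul_bot_of_pos (by positivity)]
  · rw [extLog_of_pos h, ← (tendsto_logb_geometric K m).limsup_eq]
    refine limsup_le_limsup ?_
    filter_upwards [eventually_ne_atTop 0] with n hn
    rw [← extLog_geometric hK h hn]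
    exact mul_le_mul_of_nonneg_left (extLog_mono hb (he0 n) (he n hn))
      (by exact_mod_cast (by positivity : (0 : ℝ) ≤ 1 / n))

theorem le_liminf_rate (hb : 1 < b) {e : ℕ → ℝ} {K m : ℝ} (hK : 0 < K) (hm : 0 < m)
    (he : ∀ᶠ n in atTop, K * m ^ n ≤ e n) :
    ((Real.logb b m : ℝ) : EReal) ≤
      liminf (fun n : ℕ => ((1 / (n : ℝ) : ℝ) : EReal) * extLog b (e n)) atTop := by
  rw [← (tendsto_logb_geometric K m).liminf_eq]
  refine liminf_le_liminf ?_
  filter_upwards [eventually_ne_atTop 0, he] with n hn hen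
  rw [← extLog_geometric hK hm hn]
  exact mul_le_mul_of_nonneg_left (extLog_mono hb (by positivity) hen)
    (by exact_mod_cast (by positivity : (0 : ℝ) ≤ 1 / n))

variable {r : ℕ} {p : ℝ} {q : Fin r → ℝ} {ρ : Matrix d d ℂ} {σ : Fin r → Matrix d d ℂ}

theorem extLog_chernoffQMin_le_liminf (hb : 1 < b) (hp0 : 0 < p) (hp1 : p < 1)
    (hq : ∀ i, 0 < q i) (hρ : ρ.PosSemidef) (hσ : ∀ i, (σ i).PosSemidef) (i : Fin r) :
    extLog b (chernoffQMin ρ (σ i)) ≤ liminf (errorRate b p q ρ σ) atTop := by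
  rcases (chernoffQMin_nonneg hρ (hσ i)).eq_or_lt with h | h
  · rw [← h, extLog_zero]; exact bot_le
  rw [extLog_of_pos h]
  -- The liminf does not depend on the loss `δ`, which is sent to `0` at the end.
  have hlim : Tendsto (fun δ : ℝ =>
      ((Real.logb b (chernoffQMin ρ (σ i) * Real.exp (-δ)) : ℝ) : EReal)) (𝓝[>] 0)
      (𝓝 (Real.logb b (chernoffQMin ρ (σ i)) : ℝ)) := by
    refine (continuous_coe_real_ereal.tendsto _).comp (tendsto_nhdsWithin_of_tendsto_nhds ?_)
    have hc : Continuous fun δ : ℝ => Real.logb b (chernoffQMin ρ (σ i) * Real.exp (-δ)) :=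
      Continuous.logb (by fun_prop) fun δ => by positivity
    simpa using hc.tendsto 0
  refine le_of_tendsto hlim ?_
  filter_upwards [self_mem_nhdsWithin] with δ hδ
  have hK : 0 < min p ((1 - p) * q i) / 4 := by
    have : 0 < (1 - p) * q i := mul_pos (by linarith) (hq i)
    positivity
  exact le_liminf_rate hb hK (by positivity) (eventually_le_optError hp0 hp1 hq hρ hσ i hδ h)

end Asymptotics

end StateDiscrimination

/-! ### The main theorem -/

open StateDiscrimination in
theorem mainTheorem5 {d : Type*} [Fintype d] [DecidableEq d] {r : ℕ}
    (b : ℝ) (hb : 1 < b)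
    (p : ℝ) (hp0 : 0 < p) (hp1 : p < 1)
    (q : Fin r → ℝ) (hq : ∀ i, 0 < q i) (hqsum : ∑ i, q i = 1)
    (ρ : Matrix d d ℂ) (hρ : StateDiscrimination.IsState ρ)
    (σ : Fin r → Matrix d d ℂ) (hσ : ∀ i, StateDiscrimination.IsState (σ i)) :
    (-(⨅ i, StateDiscrimination.chernoffDiv b ρ (σ i)) ≤
        liminf (StateDiscrimination.errorRate b p q ρ σ) atTop ∧
      liminf (StateDiscrimination.errorRate b p q ρ σ) atTop ≤
        limsup (StateDiscrimination.errorRate b p q ρ σ) atTop ∧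
      limsup (StateDiscrimination.errorRate b p q ρ σ) atTop ≤
        -(((1 / 2 : ℝ) : EReal) * ⨅ i, StateDiscrimination.chernoffDiv b ρ (σ i))) ∧
    (StateDiscrimination.IsPure ρ →
      Tendsto (StateDiscrimination.errorRate b p q ρ σ) atTop
        (𝓝 (-(⨅ i, StateDiscrimination.chernoffDiv b ρ (σ i))))) := by
  -- The weights sum to `1`, which rules out `r = 0`, where there would be no worst index to choose.
  have : Nonempty (Fin r) := by
    by_contra h
    rw [not_nonempty_iff] at h
    simp at hqsum
  have hρ' := hρ.posSemidef
  have hσ' := fun i => (hσ i).posSemidef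
  obtain ⟨i₀, hi₀⟩ := Finite.exists_max fun i => chernoffQMin ρ (σ i)
  set M := chernoffQMin ρ (σ i₀) with hM
  have hM0 : 0 ≤ M := chernoffQMin_nonneg hρ' (hσ' i₀)
  have hinf : ⨅ i, chernoffDiv b ρ (σ i) = -extLog b M := by
    refine le_antisymm (iInf_le _ i₀) (le_iInf fun i => ?_)
    exact EReal.neg_le_neg_iff.mpr (extLog_mono hb (chernoffQMin_nonneg hρ' (hσ' i)) (hi₀ i))
  have he0 := optError_iid_nonneg hp0 hp1 hq hρ' hσ'
  have hlow := extLog_chernoffQMin_le_liminf hb hp0 hp1 hq hρ' hσ' i₀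
  rw [hinf, neg_neg, ← extLog_sqrt hM0]
  refine ⟨⟨hlow, liminf_le_limsup, ?_⟩, fun hpure => ?_⟩
  · exact limsup_rate_le hb (K := r + 4) (by positivity) (Real.sqrt_nonneg M) he0 fun n hn =>
      optError_le_mul_sqrt_pow hp0 hp1 hq hqsum hρ hσ hM0 (chernoffQMin_le_one hρ (hσ i₀)) hi₀ hn
  · refine tendsto_of_le_liminf_of_limsup_le hlow ?_
    exact limsup_rate_le hb one_pos hM0 he0 fun n _ => by
      simpa using optError_le_pow_of_isPure hp0 hp1 hq hqsum hρ hσ hpure hM0 hi₀ n
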